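/- Let $F=\mathbb F_{25}(x,y)$ be the function field of the curve $y^5+y=x^2$ over $\mathbb F_{25}$. Then $F$ is a hyperelliptic function field of genus $2$, and there are $46$ pairwise distinct rational places $P_1,\dots,P_{46}$ of $F$ and a place $G$ of $F$ of degree two with the following property. Put $D=P_1+\dots+P_{46}$, and for integers $t_1,t_2$ with $1<t_1<t_2<23$ let $C_i=C_{\mathcal L}(D,t_iG)=\{(f(P_1),\dots,f(P_{46})) : f\in\mathcal L(t_iG)\}\subseteq\mathbb F_{25}^{46}$ for $i=1,2$. Then $C_1\subseteq C_2$, and the quantum code obtained from $C_1\subseteq C_2$ by the Calderbank-Shor-Steane construction, i.e. the span in $(\mathbb C^{25})^{\otimes 46}$ of the states $\sum_{u\in v+C_1}|u\rangle$ with $v\in C_2$, is a $[[46,\,2(t_2-t_1),\,d]]_{25}$ quantum code (a subspace of dimension $25^{2(t_2-t_1)}$ with minimum distance $d$) with $$d\ \ge\ \min\{46-2t_2,\ 2t_1-2\}.$$ Moreover, when $t_1+t_2=24$ (the case in which $46-2t_2=2t_1-2$), the Singleton defect $46+2-2(t_2-t_1)-2d$ of this code is at most $4$. -/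

import Mathlib

noncomputable section

open Polynomial

namespace AGQuantum

/-! ## Places, divisors, Riemann-Roch spaces and the genus of a function field -/

/-- A place of `F / K`, given by its valuation ring: a valuation ring `O` of `F` with
`K ⊆ O ≠ F`. The place proper is the maximal ideal of `O`, i.e. the elements of valuation
less than one for the (multiplicatively written) valuation of `O`. -/
structure Place (K F : Type*) [Field K] [Field F] [Algebra K F] where
  ring : ValuationSubring F
  algebraMap_mem : ∀ a : K, algebraMap K F a ∈ ring
  ne_top : ring ≠ ⊤

section Places

variable {K F : Type*} [Field K] [Field F] [Algebra K F]

instance (P : Place K F) : Algebra K P.ring :=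
  ((algebraMap K F).codRestrict P.ring.toSubring P.algebraMap_mem).toAlgebra

/-- The degree of a place: the dimension over `K` of its residue field. -/
def Place.degree (P : Place K F) : ℕ :=
  Module.finrank K (IsLocalRing.ResidueField P.ring)

/-- `t` is a prime element at `P`: it generates the maximal ideal of the valuation ring. -/
def Place.IsPrimeElement (P : Place K F) (t : F) : Prop :=
  P.ring.valuation t < 1 ∧
    ∀ f : F, P.ring.valuation f < 1 → P.ring.valuation f ≤ P.ring.valuation t

theorem Place.valuation_algebraMap_le (P : Place K F) (a : K) :
    P.ring.valuation (algebraMap K F a) ≤ 1 :=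
  (P.ring.valuation_le_one_iff _).2 (P.algebraMap_mem a)

variable (K F) in
/-- Divisors: the free abelian group on the places. -/
abbrev Divisor : Type _ := Place K F →₀ ℤ

/-- The degree of a divisor. -/
def Divisor.degree (A : Divisor K F) : ℤ := A.sum fun P m => m * (P.degree : ℤ)

/-- The Riemann-Roch space of `A`: all `f` with `v_P(f) ≥ -A(P)` at every place `P`. In
multiplicative notation, with `t` a prime element at `P`, this is `|f|_P ≤ |t|_P ^ (-A(P))`.
(The zero function belongs to it, since `|0|_P = 0`.) -/
def riemannRochSpace (A : Divisor K F) : Submodule K F where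
  carrier := {f | ∀ (P : Place K F) (t : F), P.IsPrimeElement t →
    P.ring.valuation f ≤ P.ring.valuation t ^ (-(A P))}
  zero_mem' := by
    intro P t _
    simp
  add_mem' := by
    intro f g hf hg P t ht
    exact (P.ring.valuation.map_add f g).trans (max_le (hf P t ht) (hg P t ht))
  smul_mem' := by
    intro a f hf P t ht
    rw [Algebra.smul_def, map_mul]
    exact (mul_le_of_le_one_left' (P.valuation_algebraMap_le a)).trans (hf P t ht)

variable (K F) in
/-- The genus: `g` is the maximum of `deg A - ℓ(A) + 1` over all divisors `A`. -/
def HasGenus (g : ℕ) : Prop :=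
  IsGreatest (Set.range fun A : Divisor K F =>
    A.degree - (Module.finrank K (riemannRochSpace A) : ℤ) + 1) (g : ℤ)

variable (K F) in
/-- A hyperelliptic function field: genus at least two, and `F` is a quadratic extension of
some rational function field `K(z)`. -/
def IsHyperelliptic : Prop :=
  (∃ g : ℕ, 2 ≤ g ∧ HasGenus K F g) ∧
    ∃ z : F, Transcendental K z ∧ Module.finrank (IntermediateField.adjoin K {z}) F = 2

/-! ## Algebraic geometry codes -/

/-- The code `C_L(D, A)` with `D = P 0 + ... + P (n - 1)`: all words `(f(P 0), ..., f(P (n-1)))`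
with `f` in the Riemann-Roch space of `A`. That `c i` is the value of `f` at `P i` means that
`f - c i` lies in the maximal ideal at `P i`. -/
def agCode {n : ℕ} (P : Fin n → Place K F) (A : Divisor K F) : Submodule K (Fin n → K) where
  carrier := {c | ∃ f ∈ riemannRochSpace A, ∀ i,
    (P i).ring.valuation (f - algebraMap K F (c i)) < 1}
  zero_mem' := ⟨0, zero_mem _, by simp⟩
  add_mem' := by
    rintro c c' ⟨f, hf, hc⟩ ⟨f', hf', hc'⟩
    refine ⟨f + f', add_mem hf hf', fun i => ?_⟩
    have h : f + f' - algebraMap K F ((c + c') i) =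
        (f - algebraMap K F (c i)) + (f' - algebraMap K F (c' i)) := by
      simp only [Pi.add_apply, map_add]
      ring
    rw [h]
    exact Valuation.map_add_lt _ (hc i) (hc' i)
  smul_mem' := by
    rintro a c ⟨f, hf, hc⟩
    refine ⟨a • f, Submodule.smul_mem _ a hf, fun i => ?_⟩
    have h : a • f - algebraMap K F ((a • c) i) =
        algebraMap K F a * (f - algebraMap K F (c i)) := by
      simp only [Pi.smul_apply, smul_eq_mul, map_mul, Algebra.smul_def]
      ring
    rw [h, map_mul]
    exact (mul_le_of_le_one_left' ((P i).valuation_algebraMap_le a)).trans_lt (hc i)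

end Places

/-! ## Quantum codes -/

/-- The state space `(ℂ^q)^{⊗ n}` for an alphabet `A` with `q` letters: the Hilbert space whose
orthonormal computational basis is indexed by the words of length `n` over `A`. -/
abbrev StateSpace (A : Type*) [Fintype A] (n : ℕ) : Type _ := EuclideanSpace ℂ (Fin n → A)

section QuantumCodes

variable {A : Type*} [Fintype A] {n : ℕ}

open Classical in
/-- The operator `N ⊗ id`, with `N` acting on the tensor factors in `S` and the identity on all
the others, as a matrix in the computational basis. -/
def localOperator (S : Finset (Fin n)) (N : Matrix (S → A) (S → A) ℂ) :
    Matrix (Fin n → A) (Fin n → A) ℂ :=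
  fun u v => if ∀ i, i ∉ S → u i = v i then N (fun i => u i) (fun i => v i) else 0

open Classical in
/-- `Q` detects the error `E`: `Π E Π = c Π` for a scalar `c`, with `Π` the orthogonal projection
onto `Q`; here through matrix elements between states of `Q`. -/
def Detects (Q : Submodule ℂ (StateSpace A n)) (E : Matrix (Fin n → A) (Fin n → A) ℂ) : Prop :=
  ∃ c : ℂ, ∀ φ ∈ Q, ∀ ψ ∈ Q, inner ℂ φ (Matrix.toEuclideanLin E ψ) = c * inner ℂ φ ψ

/-- `d` is the minimum distance of `Q`: the least number of tensor factors on which an error that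
`Q` does not detect can act. -/
def HasMinDistance (Q : Submodule ℂ (StateSpace A n)) (d : ℕ) : Prop :=
  IsLeast {w : ℕ | ∃ (S : Finset (Fin n)) (N : Matrix (S → A) (S → A) ℂ),
    S.card = w ∧ ¬ Detects Q (localOperator S N)} d

/-- `Q` is an `[[n, k, d]]_q` quantum code, where `q` is the size of the alphabet `A`. -/
def IsQuantumCode (Q : Submodule ℂ (StateSpace A n)) (k d : ℕ) : Prop :=
  Module.finrank ℂ Q = Fintype.card A ^ k ∧ HasMinDistance Q d

/-- The Singleton defect `n + 2 - k - 2d` of an `[[n, k, d]]` code. -/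
def singletonDefect (n k d : ℕ) : ℤ := (n : ℤ) + 2 - k - 2 * d

end QuantumCodes

section CSS

variable {K : Type*} [Field K] [Fintype K] {n : ℕ}

open Classical in
/-- The (unnormalized) sum of the basis states `|u⟩` over all words `u` in the coset `v + C`. -/
def cosetState (C : Submodule K (Fin n → K)) (v : Fin n → K) : StateSpace K n :=
  WithLp.toLp 2 fun u => if u - v ∈ C then 1 else 0

/-- The Calderbank-Shor-Steane code of `C₁ ⊆ C₂`: the span of the coset states of the cosets of
`C₁` in `C₂`. -/
def cssCode (C₁ C₂ : Submodule K (Fin n → K)) : Submodule ℂ (StateSpace K n) :=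
  Submodule.span ℂ (cosetState C₁ '' (C₂ : Set (Fin n → K)))

end CSS

/-! ## The function field of `y ^ 5 + y = x ^ 2` -/

section Curve

variable (K : Type*) [Field K]

/-- The polynomial `X ^ 2 - (y ^ 5 + y)` over `K(y)`. -/
def curvePoly : (RatFunc K)[X] := X ^ 2 - C (RatFunc.X ^ 5 + RatFunc.X)

instance curvePoly_irreducible : Fact (Irreducible (curvePoly K)) := by
  refine ⟨X_pow_sub_C_irreducible_of_prime Nat.prime_two fun b hb => ?_⟩
  have hdeg : (X ^ 5 + X : K[X]).natDegree = 5 := by compute_degree!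
  have h5 : (RatFunc.X ^ 5 + RatFunc.X : RatFunc K) = algebraMap K[X] (RatFunc K) (X ^ 5 + X) := by
    simp [RatFunc.algebraMap_X]
  have hne : (RatFunc.X ^ 5 + RatFunc.X : RatFunc K) ≠ 0 := by
    rw [h5]
    intro h
    have h0 : (X ^ 5 + X : K[X]) = 0 := RatFunc.algebraMap_injective K (by rw [h, map_zero])
    rw [h0] at hdeg
    simp at hdeg
  have hb0 : b ≠ 0 := by
    rintro rfl
    exact hne (by simpa using hb.symm)
  have h := congrArg RatFunc.intDegree hb
  rw [pow_two, RatFunc.intDegree_mul hb0 hb0, h5, RatFunc.intDegree_polynomial, hdeg] at h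
  push_cast at h
  omega

/-- The function field `K(x, y)` of the curve `y ^ 5 + y = x ^ 2`, as the quadratic extension of
the rational function field `K(y)` by a square root `x` of `y ^ 5 + y`. -/
abbrev CurveField : Type _ := AdjoinRoot (curvePoly K)

/-- The coordinate function `x`. -/
def curveX : CurveField K := AdjoinRoot.root (curvePoly K)

/-- The coordinate function `y`. -/
def curveY : CurveField K := AdjoinRoot.of (curvePoly K) RatFunc.X

theorem curve_equation : curveY K ^ 5 + curveY K = curveX K ^ 2 := by
  have h : AdjoinRoot.mk (curvePoly K) (X ^ 2 - C (RatFunc.X ^ 5 + RatFunc.X)) = 0 :=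
    AdjoinRoot.mk_self
  simp only [map_sub, map_pow, AdjoinRoot.mk_X, AdjoinRoot.mk_C, map_add] at h
  exact (sub_eq_zero.1 h).symm

end Curve

end AGQuantum

end

/-! The CSS code of C₁ ⊆ C₂ detects every operator on a set S of factors once no nonzero word of C₂
is supported on S and C₁ projects onto K^S (`detects_localOperator`). For the evaluation codes both
conditions are statements about Riemann-Roch spaces. A function in L(t₂G) with more than 2t₂ zeros
vanishes, which gives 46 - 2t₂. If |S| ≤ 2t₁ - 3, subtracting the places of S from t₁G leaves degree
at least 3 = 2g - 1, where ℓ = deg - 1 still holds, so the places of S impose independent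
conditions; this gives 2t₁ - 2.

Everything thus rests on ℓ(A) = deg A - 1 for deg A ≥ 3 (`ell_eq_degree_sub_one`), proved here by
explicit computation instead of duality. As y^5 + y is squarefree, the functions regular away from
infinity are a + bx with a, b in K[y] (`mem_curveRing_iff`). The involution y ↦ 1/y, x ↦ x/y^3
exchanges the origin with the only place at infinity, where y and x have poles of orders 2 and 5, so
L(n∞) can be read off from degrees. Each finite place added to n∞ with n large raises ℓ by its full
degree (`exists_le_ell_add`), and shrinking a divisor costs at most the degree lost; hence ℓ(A) ≥
deg A - 1 always, and the genus is 2. For the upper bound, a divisor of degree 3 with ℓ ≥ 3 would be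
equivalent to P + 2∞ with P rational, but L(P + 2∞) contains only linear polynomials in y.

For the places, b^5 + b is the trace of b from F_25 to F_5, and every element of F_5 is a square in
F_25. This gives at least 25 + 20 affine points, and infinity is the 46th place. The place G comes
from an explicit quadratic polynomial in y. -/

noncomputable section

open Polynomial
open WithZero (exp)
open scoped WithZero
open IsDedekindDomain

namespace AGQuantum

/-! ### Degrees of divisors and Riemann's inequality. -/

section DivisorDegree

variable {K F : Type*} [Field K] [Field F] [Algebra K F]

theorem Divisor.degree_add (A B : Divisor K F) : (A + B).degree = A.degree + B.degree := by
  classical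
  exact Finsupp.sum_add_index' (by simp) (by intros; ring)

theorem Divisor.degree_single (P : Place K F) (n : ℤ) :
    Divisor.degree (Finsupp.single P n) = n * P.degree := by
  simp [Divisor.degree]

theorem Divisor.degree_zero : (0 : Divisor K F).degree = 0 := by simp [Divisor.degree]

theorem Divisor.degree_neg (A : Divisor K F) : (-A).degree = -A.degree := by
  have := Divisor.degree_add A (-A)
  rw [add_neg_cancel, Divisor.degree_zero] at this
  linarith

theorem Divisor.degree_sub (A B : Divisor K F) : (A - B).degree = A.degree - B.degree := by
  rw [sub_eq_add_neg, Divisor.degree_add, Divisor.degree_neg, sub_eq_add_neg]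

theorem Divisor.degree_nonneg {E : Divisor K F} (hE : 0 ≤ E) : 0 ≤ E.degree :=
  Finset.sum_nonneg fun Q _ => mul_nonneg (hE Q) (Int.natCast_nonneg _)

/-- `ℓ(A)`. -/
abbrev ell (A : Divisor K F) : ℕ := Module.finrank K (riemannRochSpace A)

theorem le_ell_of_hasGenus {g : ℕ} (hg : HasGenus K F g) (A : Divisor K F) : A.degree + 1 - g ≤ ell A := by
  have := hg.2 ⟨A, rfl⟩
  simp only at this
  linarith

theorem exists_ell_eq_of_hasGenus {g : ℕ} (hg : HasGenus K F g) : ∃ B : Divisor K F, (ell B : ℤ) = B.degree + 1 - g := by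
  obtain ⟨B, hB⟩ := hg.1
  exact ⟨B, by simp only at hB; linarith⟩

end DivisorDegree

/-! ### Discrete places and the growth of ℓ. -/

section DiscretePlaces

variable {K F : Type*} [Field K] [Field F] [Algebra K F]

variable (K F) in
/-- Every place of `F / K` is discrete with a residue field finite over `K`. -/
class HasDiscretePlaces : Prop where
  exists_valuation : ∀ P : Place K F, ∃ v : Valuation F ℤᵐ⁰,
    Function.Surjective v ∧ v.valuationSubring = P.ring
  finite_residueField : ∀ P : Place K F, Module.Finite K (IsLocalRing.ResidueField P.ring)

variable [HasDiscretePlaces K F]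

instance (P : Place K F) : Module.Finite K (IsLocalRing.ResidueField P.ring) :=
  HasDiscretePlaces.finite_residueField P

/-- The normalized valuation of a discrete place. -/
def Place.val (P : Place K F) : Valuation F ℤᵐ⁰ :=
  (HasDiscretePlaces.exists_valuation P).choose

namespace Place

theorem val_surjective (P : Place K F) : Function.Surjective P.val :=
  (HasDiscretePlaces.exists_valuation P).choose_spec.1

theorem valuationSubring_val (P : Place K F) : P.val.valuationSubring = P.ring :=
  (HasDiscretePlaces.exists_valuation P).choose_spec.2

theorem val_isEquiv (P : Place K F) : P.val.IsEquiv P.ring.valuation := by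
  have h := P.val.isEquiv_valuation_valuationSubring
  rwa [valuationSubring_val] at h

theorem val_le_one_iff (P : Place K F) {f : F} : P.val f ≤ 1 ↔ f ∈ P.ring := by
  rw [P.val_isEquiv.le_one_iff_le_one, ValuationSubring.valuation_le_one_iff]

theorem val_lt_one_iff (P : Place K F) {f : F} : P.val f < 1 ↔ P.ring.valuation f < 1 :=
  P.val_isEquiv.lt_one_iff_lt_one

theorem val_algebraMap_le (P : Place K F) (a : K) : P.val (algebraMap K F a) ≤ 1 :=
  P.val_le_one_iff.2 (P.algebraMap_mem a)

theorem val_algebraMap (P : Place K F) {a : K} (ha : a ≠ 0) : P.val (algebraMap K F a) = 1 := by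
  refine le_antisymm (P.val_algebraMap_le a) ?_
  have h := P.val_algebraMap_le a⁻¹
  rw [map_inv₀, map_inv₀] at h
  exact (inv_le_one₀ (by simpa [zero_lt_iff] using ha)).1 h

theorem exists_val_eq (P : Place K F) (n : ℤ) : ∃ f, P.val f = exp n := P.val_surjective _

theorem exists_val_eq_exp (P : Place K F) {f : F} (hf : f ≠ 0) : ∃ n : ℤ, P.val f = exp n :=
  ⟨WithZero.log (P.val f), (WithZero.exp_log (by simpa using hf)).symm⟩

theorem lt_exp_iff {a : ℤᵐ⁰} {n : ℤ} : a < exp n ↔ a ≤ exp (n - 1) := by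
  rcases eq_or_ne a 0 with rfl | ha
  · simp
  · rw [← WithZero.exp_log ha, WithZero.exp_lt_exp, WithZero.exp_le_exp, Int.le_sub_one_iff]

theorem isPrimeElement_iff (P : Place K F) {t : F} :
    P.IsPrimeElement t ↔ P.val t = exp (-1) := by
  unfold IsPrimeElement
  rw [← val_lt_one_iff]
  constructor
  · rintro ⟨h1, h2⟩
    obtain ⟨u, hu⟩ := P.exists_val_eq (-1)
    refine le_antisymm ?_ ?_
    · rw [← WithZero.exp_zero, lt_exp_iff] at h1
      exact h1
    · rw [← hu]
      refine (P.val_isEquiv u t).2 (h2 u ?_)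
      rw [← val_lt_one_iff, hu, ← WithZero.exp_zero, WithZero.exp_lt_exp]
      norm_num
  · intro h
    refine ⟨?_, fun f hf => (P.val_isEquiv f t).1 ?_⟩
    · rw [h, ← WithZero.exp_zero, WithZero.exp_lt_exp]
      norm_num
    · rw [← val_lt_one_iff, ← WithZero.exp_zero, lt_exp_iff] at hf
      rw [h]
      exact hf

/-- A surjective valuation with values in `ℤᵐ⁰` is determined by its valuation ring. -/
theorem val_eq (P : Place K F) (v : Valuation F ℤᵐ⁰) (hv : Function.Surjective v)
    (h : v.valuationSubring = P.ring) : P.val = v := by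
  have he : P.val.IsEquiv v := by
    rw [Valuation.isEquiv_iff_valuationSubring, h, valuationSubring_val]
  obtain ⟨t, ht⟩ := P.exists_val_eq (-1)
  have hlt : ∀ f, P.val f < 1 ↔ v f < 1 := fun f => he.lt_one_iff_lt_one
  have h1 : (exp (-1) : ℤᵐ⁰) < 1 := by
    rw [← WithZero.exp_zero, WithZero.exp_lt_exp]
    norm_num
  have key : ∀ a : ℤᵐ⁰, a < 1 → a ≤ exp (-1) := fun a ha => by
    rwa [← WithZero.exp_zero, lt_exp_iff] at ha
  have hvt : v t = exp (-1) := by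
    obtain ⟨u, hu⟩ := hv (exp (-1))
    refine le_antisymm (key _ ((hlt t).1 (ht ▸ h1))) ?_
    rw [← hu]
    refine (he u t).1 ?_
    rw [ht]
    exact key _ ((hlt u).2 (hu ▸ h1))
  ext f
  rcases eq_or_ne f 0 with rfl | hf
  · simp
  obtain ⟨n, hn⟩ := P.exists_val_eq_exp hf
  have h2 : P.val f = P.val (t ^ (-n)) := by
    rw [hn, map_zpow₀, ht, ← WithZero.exp_zsmul]
    simp
  replace h2 : v f = v (t ^ (-n)) :=
    le_antisymm ((he _ _).1 h2.le) ((he _ _).1 h2.ge)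
  rw [h2, map_zpow₀, hvt, hn, ← WithZero.exp_zsmul]
  simp

end Place

theorem mem_riemannRochSpace {A : Divisor K F} {f : F} :
    f ∈ riemannRochSpace A ↔ ∀ P : Place K F, P.val f ≤ exp (A P) := by
  have key : ∀ (P : Place K F) (t : F), P.IsPrimeElement t →
      (P.ring.valuation f ≤ P.ring.valuation t ^ (-(A P)) ↔ P.val f ≤ exp (A P)) := by
    intro P t ht
    rw [← map_zpow₀, ← P.val_isEquiv f _, map_zpow₀, P.isPrimeElement_iff.1 ht,
      ← WithZero.exp_zsmul]
    simp
  constructor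
  · intro h P
    obtain ⟨t, ht⟩ := P.exists_val_eq (-1)
    rw [← P.isPrimeElement_iff] at ht
    exact (key P t ht).1 (h P t ht)
  · intro h P t ht
    exact (key P t ht).2 (h P)

theorem riemannRochSpace_mono {A B : Divisor K F} (h : A ≤ B) :
    riemannRochSpace A ≤ riemannRochSpace B := fun f hf => by
  rw [mem_riemannRochSpace] at hf ⊢
  exact fun P => (hf P).trans (WithZero.exp_le_exp.2 (h P))

theorem mul_mem_riemannRochSpace {A B : Divisor K F} {f g : F} (hf : f ∈ riemannRochSpace A)
    (hg : g ∈ riemannRochSpace B) : f * g ∈ riemannRochSpace (A + B) := by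
  rw [mem_riemannRochSpace] at *
  intro P
  rw [map_mul, Finsupp.add_apply, WithZero.exp_add]
  exact mul_le_mul' (hf P) (hg P)

/-- The residue class at `P` of `f * u`, for `f ∈ L(A)` and `u` of order `A(P)` at `P`. -/
def residueMap (A : Divisor K F) (P : Place K F) (u : F) (hu : P.val u = exp (-(A P))) :
    riemannRochSpace A →ₗ[K] IsLocalRing.ResidueField P.ring where
  toFun f := IsLocalRing.residue P.ring ⟨f * u, by
    rw [← P.val_le_one_iff, map_mul, hu]
    refine (mul_le_mul' (mem_riemannRochSpace.1 f.2 P) le_rfl).trans ?_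
    rw [← WithZero.exp_add, add_neg_cancel, WithZero.exp_zero]⟩
  map_add' f g := by
    rw [← map_add]
    congr 1
    ext
    simp [add_mul]
  map_smul' a f := by
    rw [RingHom.id_apply, Algebra.smul_def, IsScalarTower.algebraMap_apply K P.ring]
    refine Eq.trans ?_ (map_mul (IsLocalRing.residue P.ring) _ _)
    refine congrArg _ (Subtype.ext ?_)
    change (a • (f : F)) * u = algebraMap K F a * (f * u)
    rw [Algebra.smul_def, mul_assoc]

theorem residueMap_eq_iff {A : Divisor K F} {P : Place K F} {u : F}
    (hu : P.val u = exp (-(A P))) (f : riemannRochSpace A) (r : P.ring) :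
    residueMap A P u hu f = IsLocalRing.residue P.ring r ↔ P.val (f * u - r) < 1 := by
  unfold residueMap
  simp only [LinearMap.coe_mk, AddHom.coe_mk]
  rw [← sub_eq_zero, ← map_sub, IsLocalRing.residue_eq_zero_iff,
    ValuationSubring.valuation_lt_one_iff, P.val_lt_one_iff]
  rfl

theorem residueMap_eq_zero_iff {A : Divisor K F} {P : Place K F} {u : F}
    (hu : P.val u = exp (-(A P))) (f : riemannRochSpace A) :
    residueMap A P u hu f = 0 ↔ (f : F) ∈ riemannRochSpace (A - Finsupp.single P 1) := by
  classical
  have h0 : residueMap A P u hu f = 0 ↔ P.val (f * u) < 1 := by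
    have := residueMap_eq_iff hu f 0
    simpa using this
  have h1 : P.val (f * u) < 1 ↔ P.val f ≤ exp (A P - 1) := by
    rw [← Place.lt_exp_iff, map_mul, hu, WithZero.exp_neg, ← div_eq_mul_inv,
      div_lt_one₀ WithZero.exp_pos]
  rw [h0, h1, mem_riemannRochSpace]
  constructor
  · intro h Q
    rcases eq_or_ne P Q with rfl | hQ
    · simpa using h
    · simpa [Finsupp.single_apply, hQ] using mem_riemannRochSpace.1 f.2 Q
  · intro h
    simpa using h P

theorem Place.degree_pos (P : Place K F) : 0 < P.degree := Module.finrank_pos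

/-- Strong induction on the degree: places have positive degree, so removing one from the support
lowers it. -/
theorem Divisor.effective_induction {p : Divisor K F → Prop} (h0 : p 0)
    (h1 : ∀ E P, 0 ≤ E → p E → p (E + Finsupp.single P 1)) : ∀ E, 0 ≤ E → p E := by
  classical
  have key : ∀ n : ℕ, ∀ E : Divisor K F, 0 ≤ E → E.degree = n → p E := by
    intro n
    induction n using Nat.strong_induction_on with
    | _ n ih =>
      intro E hE hn
      by_cases hE0 : E = 0
      · rw [hE0]; exact h0
      obtain ⟨P, hP⟩ := Finsupp.ne_iff.1 hE0
      have hP1 : 1 ≤ E P := by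
        have := hE P
        rw [Finsupp.zero_apply] at this hP
        omega
      have hE' : 0 ≤ E - Finsupp.single P 1 := by
        intro Q
        rcases eq_or_ne P Q with rfl | hQ
        · simpa using hP1
        · simpa [Finsupp.single_apply, hQ] using hE Q
      have hd : Divisor.degree (E - Finsupp.single P 1) = n - P.degree := by
        rw [Divisor.degree_sub, Divisor.degree_single, hn, one_mul]
      have hnn := Divisor.degree_nonneg hE'
      have hPpos := P.degree_pos
      have := h1 _ P hE' (ih (n - P.degree) (by omega) _ hE' (by omega))
      rwa [sub_add_cancel] at this
  intro E hE
  exact key E.degree.toNat E hE (Int.toNat_of_nonneg (Divisor.degree_nonneg hE)).symm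

theorem Divisor.induction_le {p : Divisor K F → Prop} {A B : Divisor K F} (hAB : A ≤ B) (h0 : p A)
    (h1 : ∀ E P, A ≤ E → p E → p (E + Finsupp.single P 1)) : p B := by
  have := Divisor.effective_induction (p := fun E => p (A + E)) (by simpa using h0)
    (fun E P hE hp => by rw [← add_assoc]; exact h1 _ P (by simpa using hE) hp) (B - A)
    (sub_nonneg.2 hAB)
  simpa using this

/-- L(A) is the kernel of the residue map on L(A + P), whose target has dimension deg P. -/
theorem finite_and_ell_add_single (A : Divisor K F) (P : Place K F)
    (hA : Module.Finite K (riemannRochSpace A)) :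
    Module.Finite K (riemannRochSpace (A + Finsupp.single P 1)) ∧
      ell (A + Finsupp.single P 1) ≤ ell A + P.degree := by
  classical
  obtain ⟨u, hu⟩ := P.exists_val_eq (-((A + Finsupp.single P 1 : Divisor K F) P))
  set φ := residueMap _ P u hu
  have hker : ∀ f, f ∈ LinearMap.ker φ ↔ (f : F) ∈ riemannRochSpace A := fun f => by
    rw [LinearMap.mem_ker, residueMap_eq_zero_iff, add_sub_cancel_right]
  let ι : LinearMap.ker φ →ₗ[K] riemannRochSpace A :=
    ((riemannRochSpace (A + Finsupp.single P 1)).subtype ∘ₗ (LinearMap.ker φ).subtype).codRestrict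
      _ fun f => (hker f).1 f.2
  have hι : Function.Injective ι := fun f g h => by
    have := congrArg Subtype.val h
    exact Subtype.ext (Subtype.ext this)
  have hfk : Module.Finite K (LinearMap.ker φ) := Module.Finite.of_injective ι hι
  have hfq : Module.Finite K (_ ⧸ LinearMap.ker φ) := Module.Finite.equiv φ.quotKerEquivRange.symm
  have hfin := Module.Finite.of_submodule_quotient (LinearMap.ker φ)
  refine ⟨hfin, ?_⟩
  have h1 := LinearMap.finrank_range_add_finrank_ker φ
  have h2 := LinearMap.finrank_le_finrank_of_injective hι
  have h3 : Module.finrank K (LinearMap.range φ) ≤ P.degree := Submodule.finrank_le _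
  unfold ell
  omega

theorem ell_add_single_of_surjective (A : Divisor K F) (P : Place K F)
    (hA : Module.Finite K (riemannRochSpace A)) (u : F)
    (hu : P.val u = exp (-((A + Finsupp.single P 1 : Divisor K F) P)))
    (hs : Function.Surjective (residueMap _ P u hu)) :
    ell A + P.degree = ell (A + Finsupp.single P 1) := by
  have hfin := (finite_and_ell_add_single A P hA).1
  set φ := residueMap _ P u hu
  have hle : riemannRochSpace A ≤ riemannRochSpace (A + Finsupp.single P 1) :=
    riemannRochSpace_mono (by simp)
  have hker : LinearMap.ker φ = Submodule.comap (Submodule.subtype _) (riemannRochSpace A) := by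
    ext f
    rw [LinearMap.mem_ker, residueMap_eq_zero_iff, add_sub_cancel_right]
    rfl
  have h1 := LinearMap.finrank_range_add_finrank_ker φ
  rw [LinearMap.range_eq_top.2 hs, finrank_top, hker,
    (Submodule.comapSubtypeEquivOfLe hle).finrank_eq] at h1
  unfold ell
  rw [← h1, add_comm]
  rfl

theorem finite_and_ell_le {A B : Divisor K F} (hAB : A ≤ B)
    (hA : Module.Finite K (riemannRochSpace A)) :
    Module.Finite K (riemannRochSpace B) ∧ (ell B : ℤ) ≤ ell A + (B.degree - A.degree) := by
  refine Divisor.induction_le (p := fun B => Module.Finite K (riemannRochSpace B) ∧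
    (ell B : ℤ) ≤ ell A + (B.degree - A.degree)) hAB ⟨hA, by simp⟩ ?_
  rintro E P - ⟨hf, hE⟩
  obtain ⟨h1, h2⟩ := finite_and_ell_add_single E P hf
  refine ⟨h1, ?_⟩
  rw [Divisor.degree_add, Divisor.degree_single]
  have : (ell (E + Finsupp.single P 1) : ℤ) ≤ ell E + P.degree := by exact_mod_cast h2
  linarith

theorem mem_sub_single {A : Divisor K F} {f : F} (hf : f ∈ riemannRochSpace A) {P : Place K F}
    (hP : P.val f < exp (A P)) : f ∈ riemannRochSpace (A - Finsupp.single P 1) := by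
  classical
  rw [mem_riemannRochSpace] at *
  intro Q
  rcases eq_or_ne P Q with rfl | hQ
  · simpa using Place.lt_exp_iff.1 hP
  · simpa [Finsupp.single_apply, hQ] using hf Q

variable [hc : Module.Finite K (riemannRochSpace (0 : Divisor K F))]

/-- L(A ⊓ 0) is contained in L(0), and A is reached from A ⊓ 0 by adding finitely many places. -/
instance finite_riemannRochSpace (A : Divisor K F) : Module.Finite K (riemannRochSpace A) := by
  classical
  have h0 : Module.Finite K (riemannRochSpace (A ⊓ 0)) := by
    exact Submodule.finiteDimensional_of_le
      (riemannRochSpace_mono (inf_le_right : A ⊓ 0 ≤ 0))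
  exact (finite_and_ell_le inf_le_left h0).1

theorem ell_le_of_le {A B : Divisor K F} (hAB : A ≤ B) :
    (ell B : ℤ) ≤ ell A + (B.degree - A.degree) := (finite_and_ell_le hAB inferInstance).2

/-- If multiplication by `f ≠ 0` maps `L(A)` into `L(B)`, then `ℓ(A) ≤ ℓ(B)`. -/
theorem ell_le_of_mul_mem {A B : Divisor K F} {f : F} (hf : f ≠ 0)
    (h : ∀ g ∈ riemannRochSpace A, f * g ∈ riemannRochSpace B) : ell A ≤ ell B := by
  refine LinearMap.finrank_le_finrank_of_injective
    (f := ((LinearMap.mulLeft K f).restrict h)) fun g g' hg => ?_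
  have := congrArg Subtype.val hg
  exact Subtype.ext (mul_left_cancel₀ hf this)

/-! ### Consequences of a finite genus. -/

section Genus

variable {g : ℕ} (hg : HasGenus K F g)
include hg

/-- This does the work of the product formula. Take B with equality in Riemann's inequality;
multiplication by f embeds L(B - A) into L(B), so deg(B - A) + 1 - g ≤ deg B + 1 - g. -/
theorem degree_nonneg_of_mem {A : Divisor K F} {f : F} (hf : f ∈ riemannRochSpace A)
    (hf0 : f ≠ 0) : 0 ≤ A.degree := by
  obtain ⟨B, hB⟩ := exists_ell_eq_of_hasGenus hg
  have h1 : ell (B - A) ≤ ell B := ell_le_of_mul_mem hf0 fun h hh => by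
    have := mul_mem_riemannRochSpace hf hh
    rwa [add_sub_cancel] at this
  have h2 := le_ell_of_hasGenus hg (B - A)
  rw [Divisor.degree_sub] at h2
  have h3 : (ell (B - A) : ℤ) ≤ ell B := by exact_mod_cast h1
  linarith

theorem riemannRochSpace_eq_bot {A : Divisor K F} (hA : A.degree < 0) :
    riemannRochSpace A = ⊥ := by
  rw [eq_bot_iff]
  intro f hf
  by_contra hf0
  exact absurd (degree_nonneg_of_mem hg hf hf0) (not_le.2 hA)

/-- A strict inequality at P would put f into L(A - P), of negative degree. -/
theorem val_eq_of_degree_eq_zero {A : Divisor K F} {f : F} (hf : f ∈ riemannRochSpace A)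
    (hf0 : f ≠ 0) (hA : A.degree = 0) (P : Place K F) : P.val f = exp (A P) := by
  refine le_antisymm (mem_riemannRochSpace.1 hf P) (not_lt.1 fun h => ?_)
  have := degree_nonneg_of_mem hg (mem_sub_single hf h) hf0
  rw [Divisor.degree_sub, Divisor.degree_single, hA] at this
  have := P.degree_pos
  omega

/-- A nonzero element of `L(A)` with `deg A = 1` has divisor `P - A` for a rational place `P`. -/
theorem exists_val_eq_of_degree_eq_one {A : Divisor K F} {f : F} (hf : f ∈ riemannRochSpace A)
    (hf0 : f ≠ 0) (hA : A.degree = 1) : ∃ P : Place K F, P.degree = 1 ∧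
      ∀ Q, Q.val f = exp ((A - Finsupp.single P 1 : Divisor K F) Q) := by
  by_cases h : ∃ P : Place K F, P.val f < exp (A P)
  · obtain ⟨P, hP⟩ := h
    have hm := mem_sub_single hf hP
    have hd := degree_nonneg_of_mem hg hm hf0
    rw [Divisor.degree_sub, Divisor.degree_single, hA] at hd
    have := P.degree_pos
    refine ⟨P, by omega, fun Q => val_eq_of_degree_eq_zero hg hm hf0 ?_ Q⟩
    rw [Divisor.degree_sub, Divisor.degree_single, hA]
    omega
  -- If the bound is attained at every place, f⁻¹ lies in L(-A), of degree -1.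
  · push Not at h
    have hinv : f⁻¹ ∈ riemannRochSpace (-A) := by
      rw [mem_riemannRochSpace]
      intro P
      rw [map_inv₀, Finsupp.neg_apply, WithZero.exp_neg]
      exact inv_anti₀ WithZero.exp_pos (h P)
    have := degree_nonneg_of_mem hg hinv (inv_ne_zero hf0)
    rw [Divisor.degree_neg] at this
    omega

end Genus

end DiscretePlaces

/-! ### The ring of functions regular away from infinity. -/

section CurveRing

variable (K : Type*) [Field K]

theorem curvePoly_natDegree : (curvePoly K).natDegree = 2 := natDegree_X_pow_sub_C

theorem curvePoly_ne_zero : curvePoly K ≠ 0 := (curvePoly_irreducible K).out.ne_zero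

instance : FiniteDimensional (RatFunc K) (CurveField K) :=
  (AdjoinRoot.powerBasis (curvePoly_ne_zero K)).finite

theorem finrank_curveField : Module.finrank (RatFunc K) (CurveField K) = 2 := by
  rw [(AdjoinRoot.powerBasis (curvePoly_ne_zero K)).finrank, AdjoinRoot.powerBasis_dim,
    curvePoly_natDegree]

theorem algebraMap_curveField_injective : Function.Injective (algebraMap K[X] (CurveField K)) := by
  rw [IsScalarTower.algebraMap_eq K[X] (RatFunc K) (CurveField K)]
  exact (algebraMap (RatFunc K) (CurveField K)).injective.comp (RatFunc.algebraMap_injective K)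

instance : FaithfulSMul K[X] (CurveField K) :=
  (faithfulSMul_iff_algebraMap_injective _ _).2 (algebraMap_curveField_injective K)

theorem algebraMap_X_curveField : algebraMap K[X] (CurveField K) X = curveY K := by
  rw [IsScalarTower.algebraMap_apply K[X] (RatFunc K) (CurveField K), RatFunc.algebraMap_X]
  rfl

theorem algebraMap_C_curveField (a : K) :
    algebraMap K[X] (CurveField K) (C a) = algebraMap K (CurveField K) a :=
  (IsScalarTower.algebraMap_apply K K[X] (CurveField K) a).symm

variable {K}

/-- The right-hand side `y ^ 5 + y` of the curve equation. -/
abbrev curveRHS (K : Type*) [Field K] : K[X] := X ^ 5 + X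

theorem curveX_sq : curveX K ^ 2 = algebraMap K[X] (CurveField K) (curveRHS K) := by
  rw [← curve_equation, map_add, map_pow, algebraMap_X_curveField]

theorem exists_eq_add_mul_curveX (f : CurveField K) : ∃ a b : RatFunc K,
    f = algebraMap _ _ a + algebraMap _ _ b * curveX K := by
  obtain ⟨p, rfl⟩ := AdjoinRoot.mk_surjective f
  have hm : (curvePoly K).Monic := monic_X_pow_sub_C _ two_ne_zero
  have h1 : AdjoinRoot.mk (curvePoly K) p = AdjoinRoot.mk (curvePoly K) (p %ₘ curvePoly K) := by
    conv_lhs => rw [← modByMonic_add_div p (curvePoly K)]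
    rw [map_add, map_mul, AdjoinRoot.mk_self, zero_mul, add_zero]
  have h2 : (p %ₘ curvePoly K).natDegree ≤ 1 := by
    have := natDegree_modByMonic_lt p hm (fun h => by
      have h' := curvePoly_natDegree K
      rw [h] at h'
      simp at h')
    rw [curvePoly_natDegree] at this
    omega
  obtain ⟨b, a, hab⟩ := exists_eq_X_add_C_of_natDegree_le_one h2
  refine ⟨a, b, ?_⟩
  rw [h1, hab]
  simp only [map_add, map_mul, AdjoinRoot.mk_C, AdjoinRoot.mk_X]
  exact add_comm _ _

variable (K) in
/-- The involution `x ↦ -x`. -/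
def conj : CurveField K →ₐ[RatFunc K] CurveField K :=
  AdjoinRoot.liftAlgHom _ (Algebra.ofId _ _) (-curveX K) (by
    have h := curveX_sq (K := K)
    rw [IsScalarTower.algebraMap_apply K[X] (RatFunc K) (CurveField K)] at h
    refine (eval₂_sub _).trans ?_
    rw [eval₂_X_pow, eval₂_C, neg_sq, h, sub_eq_zero]
    simp [RatFunc.algebraMap_X])

theorem conj_curveX : conj K (curveX K) = -curveX K := AdjoinRoot.liftAlgHom_root ..

theorem add_mul_curveX_eq_zero {a b : RatFunc K}
    (h : algebraMap _ (CurveField K) a + algebraMap _ _ b * curveX K = 0) : a = 0 ∧ b = 0 := by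
  have h1 : AdjoinRoot.mk (curvePoly K) (C a + C b * X) = 0 := by
    rw [map_add, map_mul, AdjoinRoot.mk_C, AdjoinRoot.mk_C, AdjoinRoot.mk_X]
    exact h
  have h2 : C a + C b * X = 0 := by
    refine eq_zero_of_dvd_of_natDegree_lt (AdjoinRoot.mk_eq_zero.1 h1) ?_
    rw [curvePoly_natDegree, add_comm]
    exact Nat.lt_succ_of_le natDegree_linear_le
  constructor
  · simpa using congrArg (fun p => coeff p 0) h2
  · simpa using congrArg (fun p => coeff p 1) h2

theorem polynomial_add_mul_curveX_eq_zero {a b : K[X]}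
    (h : algebraMap _ (CurveField K) a + algebraMap _ _ b * curveX K = 0) : a = 0 ∧ b = 0 := by
  rw [IsScalarTower.algebraMap_apply K[X] (RatFunc K) (CurveField K),
    IsScalarTower.algebraMap_apply K[X] (RatFunc K) (CurveField K)] at h
  simpa using add_mul_curveX_eq_zero h

variable [CharP K 5]

theorem two_ne_zero_of_charP_five : (2 : K) ≠ 0 := by
  have h := (CharP.cast_eq_zero_iff K 5 2).not.2 (by norm_num)
  exact_mod_cast h

theorem derivative_curveRHS : derivative (curveRHS K) = 1 := by
  have h5 : (5 : K) = 0 := by exact_mod_cast CharP.cast_eq_zero K 5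
  rw [derivative_add, derivative_X_pow, derivative_X]
  simpa using h5

/-- The derivative is 1 in characteristic 5. The resulting squarefreeness makes K[y] + K[y]x
integrally closed. -/
theorem curveRHS_separable : (curveRHS K).Separable := by
  rw [Separable, derivative_curveRHS]
  exact isCoprime_one_right

instance : Algebra.IsSeparable (RatFunc K) (CurveField K) := by
  have hsep : (curvePoly K).Separable := by
    refine separable_X_pow_sub_C _ ?_ ?_
    · rw [Nat.cast_ofNat, ← map_ofNat (algebraMap K (RatFunc K)) 2]
      exact (_root_.map_ne_zero _).2 two_ne_zero_of_charP_five
    · have h : algebraMap K[X] (RatFunc K) (curveRHS K) ≠ 0 :=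
        (map_ne_zero_iff _ (RatFunc.algebraMap_injective K)).2 curveRHS_separable.ne_zero
      simpa [RatFunc.algebraMap_X] using h
  have hroot : IsSeparable (RatFunc K) (curveX K) :=
    hsep.of_dvd (minpoly.dvd _ _ ((AdjoinRoot.aeval_eq _).trans AdjoinRoot.mk_self))
  refine ⟨fun f => ?_⟩
  obtain ⟨a, b, rfl⟩ := exists_eq_add_mul_curveX f
  exact Field.isSeparable_add (isSeparable_algebraMap _)
    (Field.isSeparable_mul (isSeparable_algebraMap _) hroot)

variable (K) in
/-- The ring of functions regular away from infinity. -/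
abbrev curveRing : Subalgebra K[X] (CurveField K) := integralClosure K[X] (CurveField K)

instance : IsDedekindDomain (curveRing K) := integralClosure.isDedekindDomain K[X] (RatFunc K) _

instance : IsFractionRing (curveRing K) (CurveField K) :=
  integralClosure.isFractionRing_of_finite_extension (RatFunc K) _

omit [CharP K 5] in
theorem curveX_mem_curveRing : curveX K ∈ curveRing K := by
  have h : IsIntegral K[X] (curveX K ^ 2) := by
    rw [curveX_sq]
    exact isIntegral_algebraMap
  exact h.of_pow two_pos

/-- Adding and subtracting the conjugate and halving shows that a and bx are integral. So a is a
polynomial, and so is b²(y^5 + y); the squared denominator of b then divides the squarefree y^5 + y,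
so it is 1. -/
theorem mem_curveRing_iff {f : CurveField K} : f ∈ curveRing K ↔
    ∃ a b : K[X], f = algebraMap _ _ a + algebraMap _ _ b * curveX K := by
  constructor
  · intro hf
    obtain ⟨a, b, rfl⟩ := exists_eq_add_mul_curveX f
    have hσ : IsIntegral K[X] (conj K (algebraMap _ _ a + algebraMap _ _ b * curveX K)) :=
      IsIntegral.map ((conj K).restrictScalars K[X]) hf
    rw [map_add, map_mul, conj_curveX, AlgHom.commutes, AlgHom.commutes] at hσ
    have h2F : (2 : CurveField K) ≠ 0 := by
      rw [← map_ofNat (algebraMap K (CurveField K)) 2]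
      exact (_root_.map_ne_zero _).2 two_ne_zero_of_charP_five
    have h2i : IsIntegral K[X] ((2 : CurveField K)⁻¹) := by
      have h : IsIntegral K[X] (algebraMap K[X] (CurveField K) (C (2 : K)⁻¹)) :=
        isIntegral_algebraMap
      rwa [algebraMap_C_curveField, map_inv₀, map_ofNat] at h
    have ha : IsIntegral K[X] (algebraMap (RatFunc K) (CurveField K) a) := by
      have h := (IsIntegral.add hf hσ).mul h2i
      convert! h using 1
      field_simp
      ring
    have hb : IsIntegral K[X] (algebraMap (RatFunc K) (CurveField K)
        (b ^ 2 * algebraMap K[X] (RatFunc K) (curveRHS K))) := by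
      have h := ((IsIntegral.sub hf hσ).mul h2i).pow 2
      convert! h using 1
      rw [map_mul, map_pow, ← IsScalarTower.algebraMap_apply K[X] (RatFunc K) (CurveField K),
        ← curveX_sq]
      field_simp
      ring
    rw [isIntegral_algebraMap_iff (algebraMap (RatFunc K) (CurveField K)).injective,
      IsIntegrallyClosed.isIntegral_iff] at ha hb
    obtain ⟨a', rfl⟩ := ha
    obtain ⟨d, hd⟩ := hb
    have hb' : ∃ b' : K[X], algebraMap K[X] (RatFunc K) b' = b := by
      have hden := b.denom_ne_zero
      have hden' : algebraMap K[X] (RatFunc K) b.denom ≠ 0 := RatFunc.algebraMap_ne_zero hden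
      have hb := b.num_div_denom
      rw [← hb, div_pow, div_mul_eq_mul_div, eq_div_iff (pow_ne_zero 2 hden')] at hd
      have hd' : d * b.denom ^ 2 = b.num ^ 2 * curveRHS K :=
        RatFunc.algebraMap_injective K (by simpa using hd)
      have hdvd : b.denom ^ 2 ∣ curveRHS K :=
        (IsCoprime.pow b.isCoprime_num_denom.symm).dvd_of_dvd_mul_left (Dvd.intro_left _ hd')
      have hu : IsUnit b.denom := curveRHS_separable.squarefree _ (by rwa [← sq])
      have h1 : b.denom = 1 := b.monic_denom.isUnit_iff.1 hu
      rw [h1] at hb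
      exact ⟨b.num, by simpa using hb⟩
    obtain ⟨b', rfl⟩ := hb'
    exact ⟨a', b', by simp only [← IsScalarTower.algebraMap_apply K[X] (RatFunc K) (CurveField K)]⟩
  · rintro ⟨a, b, rfl⟩
    exact add_mem (Subalgebra.algebraMap_mem _ _)
      (mul_mem (Subalgebra.algebraMap_mem _ _) curveX_mem_curveRing)

end CurveRing

/-! ### Residue fields and pullback of places. -/

section Residue

variable {K F R : Type*} [Field K] [Field F] [Algebra K F] [CommRing R] [Algebra K R]

namespace Place

/-- The reduction at `P` of a family of functions regular at `P`. -/
def residueHom (P : Place K F) (φ : R →ₐ[K] F) (h : ∀ r, φ r ∈ P.ring) :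
    R →ₐ[K] IsLocalRing.ResidueField P.ring where
  toRingHom := (IsLocalRing.residue P.ring).comp (φ.toRingHom.codRestrict P.ring.toSubring h)
  commutes' a := by
    rw [IsScalarTower.algebraMap_apply K P.ring (IsLocalRing.ResidueField P.ring)]
    exact congrArg (IsLocalRing.residue P.ring) (Subtype.ext (φ.commutes a))

variable {P : Place K F} {φ : R →ₐ[K] F} (h : ∀ r, φ r ∈ P.ring)

theorem residueHom_eq_iff (r : R) (s : P.ring) :
    P.residueHom φ h r = IsLocalRing.residue P.ring s ↔ P.ring.valuation (φ r - s) < 1 := by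
  rw [← sub_eq_zero]
  change IsLocalRing.residue P.ring _ - _ = 0 ↔ _
  rw [← map_sub, IsLocalRing.residue_eq_zero_iff, ValuationSubring.valuation_lt_one_iff]
  rfl

theorem residueHom_eq_zero_iff (r : R) :
    P.residueHom φ h r = 0 ↔ P.ring.valuation (φ r) < 1 := by
  simpa using residueHom_eq_iff h r 0

theorem residueHom_surjective
    (hs : ∀ f ∈ P.ring, ∃ r, P.ring.valuation (φ r - f) < 1) :
    Function.Surjective (P.residueHom φ h) := by
  intro a
  obtain ⟨s, rfl⟩ := IsLocalRing.residue_surjective a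
  obtain ⟨r, hr⟩ := hs s s.2
  exact ⟨r, (residueHom_eq_iff h r s).2 hr⟩

include h in
-- Zariski's lemma: the residue field is a field that is finitely generated as a K-algebra.
theorem finite_residueField_of_surjective [Algebra.FiniteType K R]
    (hs : ∀ f ∈ P.ring, ∃ r, P.ring.valuation (φ r - f) < 1) :
    Module.Finite K (IsLocalRing.ResidueField P.ring) := by
  have := Algebra.FiniteType.of_surjective (P.residueHom φ h) (residueHom_surjective h hs)
  exact finite_of_finite_type_of_isJacobsonRing K _

/-- Polynomials represent all residue classes and p reduces to zero, so the residue field is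
K[X]/(p). -/
theorem degree_eq_natDegree {φ : K[X] →ₐ[K] F} (h : ∀ r, φ r ∈ P.ring)
    (hs : ∀ f ∈ P.ring, ∃ r, P.ring.valuation (φ r - f) < 1) {p : K[X]} (hp : Irreducible p)
    (hpP : P.ring.valuation (φ p) < 1) : P.degree = p.natDegree := by
  have hsurj := residueHom_surjective h hs
  have hker : RingHom.ker (P.residueHom φ h) = Ideal.span {p} := by
    have : (Ideal.span {p}).IsMaximal := PrincipalIdealRing.isMaximal_of_irreducible hp
    refine (this.eq_of_le (RingHom.ker_ne_top _) ?_).symm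
    rw [Ideal.span_singleton_le_iff_mem, RingHom.mem_ker, residueHom_eq_zero_iff]
    exact hpP
  have e := Ideal.quotientKerAlgEquivOfSurjective hsurj
  have e2 := Ideal.quotientEquivAlgOfEq K hker
  unfold degree
  rw [← (e2.symm.trans e).toLinearEquiv.finrank_eq]
  exact (AdjoinRoot.powerBasis hp.ne_zero).finrank

/-- The pullback of a place along an automorphism. -/
def comap (P : Place K F) (e : F ≃ₐ[K] F) : Place K F where
  ring := P.ring.comap e.toRingEquiv.toRingHom
  algebraMap_mem a := by
    rw [ValuationSubring.mem_comap]
    simpa using P.algebraMap_mem a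
  ne_top h := P.ne_top <| eq_top_iff.2 fun f _ => by
    have : e.symm f ∈ P.ring.comap e.toRingEquiv.toRingHom := h ▸ ValuationSubring.mem_top _
    rw [ValuationSubring.mem_comap] at this
    simpa using this

theorem mem_comap {P : Place K F} {e : F ≃ₐ[K] F} {f : F} :
    f ∈ (P.comap e).ring ↔ e f ∈ P.ring := Iff.rfl

theorem comap_comap (P : Place K F) (e e' : F ≃ₐ[K] F) :
    (P.comap e).comap e' = P.comap (e'.trans e) := rfl

theorem comap_refl (P : Place K F) : P.comap AlgEquiv.refl = P := rfl

theorem valuation_lt_one_iff_inv (P : Place K F) (f : F) :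
    P.ring.valuation f < 1 ↔ f = 0 ∨ f⁻¹ ∉ P.ring := by
  rw [← ValuationSubring.mem_nonunits_iff, ValuationSubring.mem_nonunits_iff_or]

theorem comap_valuation_lt_one_iff {P : Place K F} {e : F ≃ₐ[K] F} {f : F} :
    (P.comap e).ring.valuation f < 1 ↔ P.ring.valuation (e f) < 1 := by
  rw [valuation_lt_one_iff_inv, valuation_lt_one_iff_inv, mem_comap, map_inv₀,
    EmbeddingLike.map_eq_zero_iff]

end Place

end Residue

/-! ### Places centred on a Dedekind domain. -/

section Dedekind

variable {K F R : Type*} [Field K] [Field F] [Algebra K F] [CommRing R] [IsDedekindDomain R]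
  [Algebra K R] [Algebra R F] [IsScalarTower K R F] [IsFractionRing R F]

variable (K F) in
/-- The place given by a nonzero prime of a Dedekind domain with quotient field `F`. -/
def placeOfPrime (v : HeightOneSpectrum R) : Place K F where
  ring := (v.valuation F).valuationSubring
  algebraMap_mem a := by
    rw [IsScalarTower.algebraMap_apply K R F]
    exact v.valuation_le_one _
  ne_top h := (Valuation.valuationSubring_eq_top_iff _).1 h inferInstance

theorem placeOfPrime_valuation_lt_one_iff (v : HeightOneSpectrum R) (f : F) :
    (placeOfPrime K F v).ring.valuation f < 1 ↔ v.valuation F f < 1 :=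
  (v.valuation F).isEquiv_valuation_valuationSubring.lt_one_iff_lt_one.symm

theorem algebraMap_mem_placeOfPrime (v : HeightOneSpectrum R) (r : R) :
    algebraMap R F r ∈ (placeOfPrime K F v).ring := v.valuation_le_one r

theorem exists_algebraMap_sub_lt_one (v : HeightOneSpectrum R) {f : F}
    (hf : f ∈ (placeOfPrime K F v).ring) :
    ∃ r : R, (placeOfPrime K F v).ring.valuation (algebraMap R F r - f) < 1 := by
  obtain ⟨r, hr⟩ := v.exists_valuation_sub_lt_of_integer hf 1
  exact ⟨r, (placeOfPrime_valuation_lt_one_iff v _).2 hr⟩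

/-- The centre 𝔭 of P is nonzero, as otherwise all fractions would lie in `P.ring`. The localization
at 𝔭 is a discrete valuation ring inside `P.ring`, and such a ring is maximal among proper valuation
subrings. -/
theorem exists_eq_placeOfPrime (P : Place K F) (h : ∀ r : R, algebraMap R F r ∈ P.ring) :
    ∃ v : HeightOneSpectrum R, P = placeOfPrime K F v := by
  let φ : R →+* P.ring := (algebraMap R F).codRestrict P.ring.toSubring h
  let 𝔭 := Ideal.comap φ (IsLocalRing.maximalIdeal P.ring)
  have hmem : ∀ r, r ∉ 𝔭 → P.ring.valuation (algebraMap R F r) = 1 := fun r hr => by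
    rcases P.ring.valuation_lt_one_or_eq_one (φ r) with h | h
    · exact absurd ((P.ring.valuation_lt_one_iff _).2 h) hr
    · exact h
  have hbot : 𝔭 ≠ ⊥ := fun hb => P.ne_top <| eq_top_iff.2 fun f _ => by
    obtain ⟨a, b, hb0, rfl⟩ := IsFractionRing.div_surjective (A := R) f
    rw [← ValuationSubring.valuation_le_one_iff, map_div₀,
      hmem b (by rw [hb]; exact nonZeroDivisors.ne_zero hb0), div_one,
      ValuationSubring.valuation_le_one_iff]
    exact h a
  let v : HeightOneSpectrum R := ⟨𝔭, inferInstance, hbot⟩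
  have hle : HeightOneSpectrum.valuationSubringAtPrime F v ≤ P.ring := by
    rw [HeightOneSpectrum.valuationSubringAtPrime_eq_valuationSubring]
    intro f hf
    obtain ⟨n, d, hd⟩ := v.exists_primeCompl_mul_eq_of_integer f hf
    have h1 := hmem d d.2
    have h2 : P.ring.valuation f = P.ring.valuation (algebraMap R F n) := by
      rw [← hd, map_mul, h1, mul_one]
    rw [← ValuationSubring.valuation_le_one_iff, h2, ValuationSubring.valuation_le_one_iff]
    exact h n
  have heq := ValuationSubring.eq_of_le_of_ne_top _ hle P.ne_top
  rw [HeightOneSpectrum.valuationSubringAtPrime_eq_valuationSubring] at heq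
  refine ⟨v, ?_⟩
  cases P
  simp only at heq
  simp only [placeOfPrime, heq]

/-- An element of `F` with a simple pole at `v` and no other pole among the primes of `R`. -/
theorem exists_valuation_eq_exp_one (v : HeightOneSpectrum R) : ∃ h : F,
    v.valuation F h = exp 1 ∧ ∀ w : HeightOneSpectrum R, w ≠ v → w.valuation F h ≤ 1 := by
  -- h lies in the inverse ideal of v but not in R.
  obtain ⟨h, hh, hh1⟩ := FractionalIdeal.exists_notMem_one_of_ne_bot (K := F) v.ne_bot
    v.isPrime.ne_top
  have hmul : ∀ r ∈ v.asIdeal, ∀ w : HeightOneSpectrum R,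
      w.valuation F h * w.valuation F (algebraMap R F r) ≤ 1 := by
    intro r hr w
    rw [FractionalIdeal.mem_inv_iff (FractionalIdeal.coeIdeal_ne_zero.2 v.ne_bot)] at hh
    obtain ⟨s, hs⟩ := (FractionalIdeal.mem_one_iff _).1
      (hh _ ((FractionalIdeal.mem_coeIdeal _).2 ⟨r, hr, rfl⟩))
    rw [← map_mul, ← hs]
    exact w.valuation_le_one s
  have hother : ∀ w : HeightOneSpectrum R, w ≠ v → w.valuation F h ≤ 1 := by
    intro w hw
    obtain ⟨r, hr, hrw⟩ : ∃ r ∈ v.asIdeal, r ∉ w.asIdeal := by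
      by_contra! hle
      have : v.asIdeal = w.asIdeal := v.isMaximal.eq_of_le w.isPrime.ne_top hle
      exact hw (HeightOneSpectrum.ext this).symm
    have h1 := hmul r hr w
    rwa [(w.valuation_eq_one_iff_notMem).2 hrw, mul_one] at h1
  refine ⟨h, le_antisymm ?_ ?_, hother⟩
  · obtain ⟨t, ht⟩ := v.intValuation_exists_uniformizer
    have htv : v.valuation F (algebraMap R F t) = exp (-1) := by
      rw [HeightOneSpectrum.valuation_of_algebraMap]; exact ht
    have htm : t ∈ v.asIdeal := by
      rw [← HeightOneSpectrum.valuation_lt_one_iff_mem (K := F), htv, ← WithZero.exp_zero,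
        WithZero.exp_lt_exp]
      norm_num
    have h1 := hmul t htm v
    rwa [htv, WithZero.exp_neg, ← div_eq_mul_inv, div_le_one₀ WithZero.exp_pos] at h1
  -- Without a pole at v, h would be integral at every prime and hence lie in R.
  · by_contra hlt
    rw [not_le, Place.lt_exp_iff, sub_self, WithZero.exp_zero] at hlt
    refine hh1 ((FractionalIdeal.mem_one_iff _).2 ?_)
    refine HeightOneSpectrum.mem_integers_of_valuation_le_one F h fun w => ?_
    rcases eq_or_ne w v with rfl | hw
    · exact hlt
    · exact hother w hw

end Dedekind

/-! ### Places of the curve: finite primes and the inversion. -/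

section CurvePlaces

variable {K : Type*} [Field K]

theorem algebraMap_eq_aeval (p : K[X]) :
    algebraMap K[X] (CurveField K) p = aeval (curveY K) p := by
  rw [← algebraMap_X_curveField, aeval_algebraMap_apply, aeval_X_left_apply]

theorem transcendental_curveY : Transcendental K (curveY K) := by
  rw [transcendental_iff_injective]
  intro p q h
  rw [← algebraMap_eq_aeval, ← algebraMap_eq_aeval] at h
  exact algebraMap_curveField_injective K h

theorem curveY_ne_zero : curveY K ≠ 0 := fun h => transcendental_curveY (K := K) (h ▸ isAlgebraic_zero)

theorem curveField_algHom_ext {e e' : CurveField K →ₐ[K] CurveField K}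
    (hx : e (curveX K) = e' (curveX K)) (hy : e (curveY K) = e' (curveY K)) : e = e' := by
  have hp : ∀ p : K[X], e (algebraMap _ _ p) = e' (algebraMap _ _ p) := fun p => by
    rw [algebraMap_eq_aeval, ← aeval_algHom_apply, ← aeval_algHom_apply, hy]
  have hr : ∀ a : RatFunc K, e (algebraMap _ _ a) = e' (algebraMap _ _ a) := fun a => by
    rw [← a.num_div_denom, map_div₀, ← IsScalarTower.algebraMap_apply,
      ← IsScalarTower.algebraMap_apply, map_div₀, map_div₀, hp, hp]
  refine AlgHom.ext fun f => ?_
  obtain ⟨a, b, rfl⟩ := exists_eq_add_mul_curveX f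
  rw [map_add, map_add, map_mul, map_mul, hr, hr, hx]

theorem transcendental_inv_curveY : Transcendental K (curveY K)⁻¹ :=
  fun h => transcendental_curveY (IsAlgebraic.inv_iff.1 h)

theorem nonZeroDivisors_le_comap_aeval_inv : nonZeroDivisors K[X] ≤
    (nonZeroDivisors (CurveField K)).comap (aeval (R := K) (curveY K)⁻¹) :=
  nonZeroDivisors_le_comap_nonZeroDivisors_of_injective _
    (transcendental_iff_injective.1 transcendental_inv_curveY)

variable (K) in
/-- The endomorphism `y ↦ 1 / y`, `x ↦ x / y ^ 3`. -/
def inversionHom : CurveField K →ₐ[K] CurveField K :=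
  AdjoinRoot.liftAlgHom _
    (RatFunc.liftAlgHom (aeval (curveY K)⁻¹) nonZeroDivisors_le_comap_aeval_inv)
    (curveX K / curveY K ^ 3) (by
      -- The new coordinates satisfy the curve equation: (x/y^3)^2 = (y^5 + y)/y^6 = y^(-1) +
      -- y^(-5).
      refine (eval₂_sub _).trans ?_
      rw [eval₂_X_pow, eval₂_C, sub_eq_zero]
      have h : (RatFunc.X ^ 5 + RatFunc.X : RatFunc K) =
          algebraMap K[X] (RatFunc K) (X ^ 5 + X) / algebraMap K[X] (RatFunc K) 1 := by
        simp [RatFunc.algebraMap_X]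
      rw [h]
      refine Eq.trans ?_
        (RatFunc.liftAlgHom_apply_div _ nonZeroDivisors_le_comap_aeval_inv _ _).symm
      have hy := curveY_ne_zero (K := K)
      rw [div_pow, ← curve_equation]
      simp only [map_add, map_pow, aeval_X, map_one]
      field_simp
      ring)

theorem inversionHom_curveX : inversionHom K (curveX K) = curveX K / curveY K ^ 3 :=
  AdjoinRoot.liftAlgHom_root ..

theorem inversionHom_curveY : inversionHom K (curveY K) = (curveY K)⁻¹ := by
  refine (AdjoinRoot.liftAlgHom_of ..).trans ?_
  have h : (RatFunc.X : RatFunc K) =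
      algebraMap K[X] (RatFunc K) X / algebraMap K[X] (RatFunc K) 1 := by
    simp [RatFunc.algebraMap_X]
  rw [h]
  refine (RatFunc.liftAlgHom_apply_div _ nonZeroDivisors_le_comap_aeval_inv _ _).trans ?_
  simp

theorem inversionHom_comp_self : (inversionHom K).comp (inversionHom K) = AlgHom.id K _ := by
  have hy := curveY_ne_zero (K := K)
  refine curveField_algHom_ext ?_ ?_
  · simp only [AlgHom.comp_apply, inversionHom_curveX, map_div₀, map_pow, inversionHom_curveY,
      AlgHom.id_apply]
    field_simp
  · simp [inversionHom_curveY]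

variable (K) in
/-- The automorphism `y ↦ 1 / y`, `x ↦ x / y ^ 3`. -/
def inversion : CurveField K ≃ₐ[K] CurveField K :=
  AlgEquiv.ofAlgHom (inversionHom K) (inversionHom K) inversionHom_comp_self
    inversionHom_comp_self

theorem inversion_curveX : inversion K (curveX K) = curveX K / curveY K ^ 3 := inversionHom_curveX

theorem inversion_curveY : inversion K (curveY K) = (curveY K)⁻¹ := inversionHom_curveY

theorem inversion_trans_self : (inversion K).trans (inversion K) = AlgEquiv.refl := by
  ext f
  exact DFunLike.congr_fun inversionHom_comp_self f

/-- The coordinate function `x` as an element of the ring of functions regular away from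
infinity. -/
def curveRingX (K : Type*) [Field K] : integralClosure K[X] (CurveField K) :=
  ⟨curveX K, curveX_mem_curveRing⟩

theorem algebraMap_mem_of_curveY_mem {P : Place K (CurveField K)} (hP : curveY K ∈ P.ring)
    (p : K[X]) : algebraMap K[X] (CurveField K) p ∈ P.ring := by
  rw [algebraMap_eq_aeval, aeval_eq_sum_range]
  refine sum_mem fun i _ => ?_
  rw [Algebra.smul_def]
  exact mul_mem (P.algebraMap_mem _) (pow_mem hP i)

theorem curveX_mem_of_curveY_mem {P : Place K (CurveField K)} (hP : curveY K ∈ P.ring) :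
    curveX K ∈ P.ring := by
  have h : curveX K ^ 2 ∈ P.ring := by
    rw [curveX_sq]
    exact algebraMap_mem_of_curveY_mem hP _
  rw [← ValuationSubring.valuation_le_one_iff, map_pow] at h
  rw [← ValuationSubring.valuation_le_one_iff]
  exact (pow_le_one_iff two_ne_zero).1 h

variable [CharP K 5]

theorem mem_of_curveY_mem {P : Place K (CurveField K)} (hP : curveY K ∈ P.ring)
    (r : curveRing K) : algebraMap (curveRing K) (CurveField K) r ∈ P.ring := by
  obtain ⟨r, hr⟩ := r
  obtain ⟨a, b, rfl⟩ := mem_curveRing_iff.1 hr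
  exact add_mem (algebraMap_mem_of_curveY_mem hP a)
    (mul_mem (algebraMap_mem_of_curveY_mem hP b) (curveX_mem_of_curveY_mem hP))

instance : Module.Finite K[X] (curveRing K) :=
  IsIntegralClosure.finite K[X] (RatFunc K) (CurveField K) (curveRing K)

instance : Algebra.FiniteType K (curveRing K) :=
  Algebra.FiniteType.trans (S := K[X]) inferInstance inferInstance

theorem exists_eq_placeOfPrime_of_curveY_mem {P : Place K (CurveField K)}
    (hP : curveY K ∈ P.ring) :
    ∃ v : HeightOneSpectrum (curveRing K), P = placeOfPrime K (CurveField K) v :=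
  exists_eq_placeOfPrime P (mem_of_curveY_mem hP)

theorem curveY_mem_placeOfPrime (v : HeightOneSpectrum (curveRing K)) :
    curveY K ∈ (placeOfPrime K (CurveField K) v).ring := by
  have := algebraMap_mem_placeOfPrime (K := K) (F := CurveField K) v (algebraMap K[X] _ X)
  rwa [← IsScalarTower.algebraMap_apply K[X] (curveRing K) (CurveField K),
    algebraMap_X_curveField] at this

omit [CharP K 5] in
theorem curveY_mem_comap_inversion {P : Place K (CurveField K)} (hP : curveY K ∉ P.ring) :
    curveY K ∈ (P.comap (inversion K)).ring := by
  rw [Place.mem_comap, inversion_curveY]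
  exact (P.ring.mem_or_inv_mem _).resolve_left hP

/-- Every place is a prime of the ring of regular functions, up to the inversion. -/
theorem exists_comap_eq_placeOfPrime (P : Place K (CurveField K)) :
    ∃ (e : CurveField K ≃ₐ[K] CurveField K) (v : HeightOneSpectrum (curveRing K)),
      P = (placeOfPrime K (CurveField K) v).comap e := by
  by_cases hP : curveY K ∈ P.ring
  · obtain ⟨v, hv⟩ := exists_eq_placeOfPrime_of_curveY_mem hP
    exact ⟨AlgEquiv.refl, v, hv⟩
  · obtain ⟨v, hv⟩ := exists_eq_placeOfPrime_of_curveY_mem (curveY_mem_comap_inversion hP)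
    exact ⟨inversion K, v, by rw [← hv, Place.comap_comap, inversion_trans_self]; rfl⟩

instance : HasDiscretePlaces K (CurveField K) where
  exists_valuation P := by
    obtain ⟨e, v, rfl⟩ := exists_comap_eq_placeOfPrime P
    refine ⟨(v.valuation (CurveField K)).comap e.toRingEquiv.toRingHom, ?_, rfl⟩
    exact (HeightOneSpectrum.valuation_surjective _ v).comp e.surjective
  finite_residueField P := by
    obtain ⟨e, v, rfl⟩ := exists_comap_eq_placeOfPrime P
    let φ : curveRing K →ₐ[K] CurveField K :=
      e.symm.toAlgHom.comp ((curveRing K).val.restrictScalars K)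
    have hφ : ∀ r, e (φ r) = algebraMap (curveRing K) (CurveField K) r := fun r =>
      e.apply_symm_apply _
    refine Place.finite_residueField_of_surjective (φ := φ) (fun r => ?_) (fun f hf => ?_)
    · rw [Place.mem_comap, hφ]
      exact algebraMap_mem_placeOfPrime v r
    · obtain ⟨r, hr⟩ := exists_algebraMap_sub_lt_one v (Place.mem_comap.1 hf)
      exact ⟨r, by rwa [Place.comap_valuation_lt_one_iff, map_sub, hφ]⟩

theorem val_placeOfPrime (v : HeightOneSpectrum (curveRing K)) :
    (placeOfPrime K (CurveField K) v).val = v.valuation (CurveField K) :=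
  Place.val_eq _ _ (HeightOneSpectrum.valuation_surjective _ v) rfl

/-- Setting x = s maps K[y] + K[y]x to K[y]/(p), since p divides y^5 + y - s²; so the ideal (p, x -
s) is proper and lies in a maximal one, nonzero because x ≠ s. This constructs all the closed points
needed later. -/
theorem exists_prime_of_dvd {p s : K[X]} (hp : ¬ IsUnit p) (h : p ∣ curveRHS K - s ^ 2) :
    ∃ v : HeightOneSpectrum (curveRing K), algebraMap K[X] _ p ∈ v.asIdeal ∧
      curveRingX K - algebraMap K[X] _ s ∈ v.asIdeal := by
  set J : Ideal (curveRing K) :=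
    Ideal.span {algebraMap K[X] _ p, curveRingX K - algebraMap K[X] _ s} with hJ
  have hJ1 : J ≠ ⊤ := by
    rw [Ne, Ideal.eq_top_iff_one, hJ, Ideal.mem_span_pair]
    rintro ⟨⟨r, hr⟩, ⟨t, ht⟩, hrt⟩
    obtain ⟨r0, r1, rfl⟩ := mem_curveRing_iff.1 hr
    obtain ⟨t0, t1, rfl⟩ := mem_curveRing_iff.1 ht
    have hrt' := congrArg Subtype.val hrt
    change (_ + _ * curveX K) * algebraMap K[X] (CurveField K) p +
      (_ + _ * curveX K) * (curveX K - algebraMap K[X] (CurveField K) s) = 1 at hrt'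
    have h0 : algebraMap K[X] (CurveField K) (r0 * p + t1 * curveRHS K - t0 * s - 1) +
        algebraMap K[X] (CurveField K) (r1 * p + t0 - t1 * s) * curveX K = 0 := by
      have := curveX_sq (K := K)
      simp only [map_add, map_sub, map_mul, map_one] at this ⊢
      linear_combination hrt' - algebraMap K[X] (CurveField K) t1 * this
    obtain ⟨h1, h2⟩ := polynomial_add_mul_curveX_eq_zero h0
    refine hp (isUnit_of_dvd_one ?_)
    obtain ⟨d, hd⟩ := h
    -- The relation 1 ∈ (p, x - s) evaluated at x = s, where d is the quotient of y^5 + y - s² by p.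
    refine ⟨r0 + r1 * s + t1 * d, ?_⟩
    linear_combination -h1 - s * h2 + t1 * hd
  obtain ⟨M, hM, hJM⟩ := Ideal.exists_le_maximal J hJ1
  have hx : curveRingX K - algebraMap K[X] _ s ∈ M := hJM (Ideal.subset_span (by simp))
  have hM0 : M ≠ ⊥ := by
    rintro rfl
    have h1 := congrArg Subtype.val ((Ideal.mem_bot).1 hx)
    change curveX K - algebraMap K[X] (CurveField K) s = 0 at h1
    have h0 : algebraMap K[X] (CurveField K) (-s) +
        algebraMap K[X] (CurveField K) 1 * curveX K = 0 := by
      rw [map_neg, map_one]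
      linear_combination h1
    exact one_ne_zero (polynomial_add_mul_curveX_eq_zero h0).2
  exact ⟨⟨M, hM.isPrime, hM0⟩, hJM (Ideal.subset_span (by simp)), hx⟩

end CurvePlaces

/-! ### The place at infinity, its Riemann-Roch spaces, and the genus. -/

section Infinity

variable {K : Type*} [Field K] [CharP K 5]

omit [CharP K 5] in
-- Modulo v one has a + bx ≡ a + bs, and v contracts to the maximal ideal (p) of K[y].
theorem mem_prime_iff {v : HeightOneSpectrum (curveRing K)} {p s : K[X]} (hp : Irreducible p)
    (h1 : algebraMap K[X] _ p ∈ v.asIdeal) (h2 : curveRingX K - algebraMap K[X] _ s ∈ v.asIdeal)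
    (a b : K[X]) :
    algebraMap K[X] _ a + algebraMap K[X] _ b * curveRingX K ∈ v.asIdeal ↔ p ∣ a + b * s := by
  have hmax : (Ideal.span {p}).IsMaximal := PrincipalIdealRing.isMaximal_of_irreducible hp
  have hcomap : v.asIdeal.comap (algebraMap K[X] (curveRing K)) = Ideal.span {p} := by
    refine (hmax.eq_of_le (Ideal.comap_ne_top _ v.isPrime.ne_top) ?_).symm
    rwa [Ideal.span_singleton_le_iff_mem, Ideal.mem_comap]
  have h3 : algebraMap K[X] _ a + algebraMap K[X] _ b * curveRingX K =
      algebraMap K[X] _ (a + b * s) +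
        algebraMap K[X] _ b * (curveRingX K - algebraMap K[X] _ s) := by
    rw [map_add, map_mul]
    ring
  rw [h3, Ideal.add_mem_iff_left _ (Ideal.mul_mem_left _ _ h2), ← Ideal.mem_comap, hcomap,
    Ideal.mem_span_singleton]

theorem exists_eq_curveRing (r : curveRing K) :
    ∃ a b : K[X], r = algebraMap K[X] _ a + algebraMap K[X] _ b * curveRingX K := by
  obtain ⟨a, b, h⟩ := mem_curveRing_iff.1 r.2
  exact ⟨a, b, Subtype.ext h⟩

theorem prime_eq_of_mem {v w : HeightOneSpectrum (curveRing K)} {p s : K[X]} (hp : Irreducible p)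
    (hv1 : algebraMap K[X] _ p ∈ v.asIdeal) (hv2 : curveRingX K - algebraMap K[X] _ s ∈ v.asIdeal)
    (hw1 : algebraMap K[X] _ p ∈ w.asIdeal)
    (hw2 : curveRingX K - algebraMap K[X] _ s ∈ w.asIdeal) : v = w := by
  refine HeightOneSpectrum.ext (Ideal.ext fun r => ?_)
  obtain ⟨a, b, rfl⟩ := exists_eq_curveRing r
  rw [mem_prime_iff hp hv1 hv2, mem_prime_iff hp hw1 hw2]

/-- As x ≡ s, polynomials in y represent every residue class, and the residue field is K[y]/(p). The
automorphism e is carried along to cover the place at infinity. -/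
theorem degree_comap_placeOfPrime {v : HeightOneSpectrum (curveRing K)} {p s : K[X]}
    (hp : Irreducible p) (h1 : algebraMap K[X] _ p ∈ v.asIdeal)
    (h2 : curveRingX K - algebraMap K[X] _ s ∈ v.asIdeal)
    (e : CurveField K ≃ₐ[K] CurveField K) :
    ((placeOfPrime K (CurveField K) v).comap e).degree = p.natDegree := by
  let ψ : K[X] →ₐ[K] CurveField K := (Algebra.ofId K[X] (CurveField K)).restrictScalars K
  let φ : K[X] →ₐ[K] CurveField K := e.symm.toAlgHom.comp ψ
  have hφ : ∀ r, e (φ r) = algebraMap (curveRing K) (CurveField K) (algebraMap K[X] _ r) :=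
    fun r => e.apply_symm_apply _
  refine Place.degree_eq_natDegree (φ := φ) (fun r => ?_) (fun f hf => ?_) hp ?_
  · rw [Place.mem_comap, hφ]
    exact algebraMap_mem_placeOfPrime v _
  · obtain ⟨r, hr⟩ := exists_algebraMap_sub_lt_one v (Place.mem_comap.1 hf)
    obtain ⟨a, b, rfl⟩ := exists_eq_curveRing r
    refine ⟨a + b * s, ?_⟩
    rw [Place.comap_valuation_lt_one_iff, map_sub, hφ]
    have h3 : algebraMap K[X] (curveRing K) (a + b * s) =
        (algebraMap K[X] _ a + algebraMap K[X] _ b * curveRingX K) +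
        -(algebraMap K[X] _ b * (curveRingX K - algebraMap K[X] _ s)) := by
      rw [map_add, map_mul]
      ring
    rw [h3, map_add, add_sub_right_comm]
    refine Valuation.map_add_lt _ hr ?_
    rw [placeOfPrime_valuation_lt_one_iff, HeightOneSpectrum.valuation_lt_one_iff_mem]
    exact neg_mem (Ideal.mul_mem_left _ _ h2)
  · rw [Place.comap_valuation_lt_one_iff, hφ, placeOfPrime_valuation_lt_one_iff,
      HeightOneSpectrum.valuation_lt_one_iff_mem]
    exact h1

variable (K) in
theorem exists_origin : ∃ v : HeightOneSpectrum (curveRing K), algebraMap K[X] _ X ∈ v.asIdeal ∧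
    curveRingX K - algebraMap K[X] _ 0 ∈ v.asIdeal :=
  exists_prime_of_dvd not_isUnit_X ⟨X ^ 4 + 1, by ring⟩

variable (K) in
/-- The prime `(x, y)` of the ring of functions regular away from infinity. -/
def origin : HeightOneSpectrum (curveRing K) := (exists_origin K).choose

theorem X_mem_origin : algebraMap K[X] _ X ∈ (origin K).asIdeal :=
  (exists_origin K).choose_spec.1

theorem curveRingX_sub_mem_origin : curveRingX K - algebraMap K[X] _ 0 ∈ (origin K).asIdeal :=
  (exists_origin K).choose_spec.2

theorem curveRingX_mem_origin : curveRingX K ∈ (origin K).asIdeal := by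
  simpa using curveRingX_sub_mem_origin (K := K)

omit [CharP K 5] in
theorem curveRingX_sq : curveRingX K ^ 2 = algebraMap K[X] _ (curveRHS K) :=
  Subtype.ext curveX_sq

/-- x² = y(y^4 + 1), and y^4 + 1 is a unit at the origin. -/
theorem intValuation_origin_X :
    (origin K).intValuation (algebraMap K[X] _ X) = (origin K).intValuation (curveRingX K) ^ 2 := by
  have h : (origin K).intValuation (algebraMap K[X] _ (X ^ 4 + 1)) = 1 := by
    rw [HeightOneSpectrum.intValuation_eq_one_iff]
    have h1 := mem_prime_iff irreducible_X X_mem_origin curveRingX_sub_mem_origin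
      (X ^ 4 + 1 : K[X]) 0
    rw [map_zero, zero_mul, add_zero] at h1
    rw [h1, X_dvd_iff]
    simp
  rw [← map_pow, curveRingX_sq, ← mul_one ((origin K).intValuation (algebraMap K[X] _ X)), ← h,
    ← map_mul, ← map_mul]
  congr 2
  ring

/-- A uniformizer a + bx at the origin has y ∣ a. As y has the order of x², both terms have at least
the order of x, which is therefore 1. -/
theorem intValuation_origin_curveRingX :
    (origin K).intValuation (curveRingX K) = exp (-1) := by
  have hlt := ((origin K).intValuation_lt_one_iff_mem _).2 curveRingX_mem_origin
  refine le_antisymm ?_ ?_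
  · rwa [← WithZero.exp_zero, Place.lt_exp_iff] at hlt
  obtain ⟨t, ht⟩ := (origin K).intValuation_exists_uniformizer
  have htm : t ∈ (origin K).asIdeal := by
    rw [← HeightOneSpectrum.intValuation_lt_one_iff_mem, ht]
    exact WithZero.exp_lt_exp.2 (by norm_num : (-1 : ℤ) < 0)
  obtain ⟨a, b, rfl⟩ := exists_eq_curveRing t
  have ha := (mem_prime_iff irreducible_X X_mem_origin curveRingX_sub_mem_origin a b).1 htm
  rw [mul_zero, add_zero] at ha
  obtain ⟨c, rfl⟩ := ha
  refine ht.ge.trans (Valuation.map_add_le _ ?_ ?_)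
  · rw [map_mul, map_mul, intValuation_origin_X]
    calc _ ≤ (origin K).intValuation (curveRingX K) ^ 2 * 1 :=
          mul_le_mul' le_rfl ((origin K).intValuation_le_one _)
      _ ≤ _ := by
          rw [mul_one, sq]
          exact mul_le_of_le_one_left' hlt.le
  · rw [map_mul]
    exact mul_le_of_le_one_left' ((origin K).intValuation_le_one _)

variable (K) in
/-- The place at infinity. -/
def infinityPlace : Place K (CurveField K) :=
  (placeOfPrime K (CurveField K) (origin K)).comap (inversion K)

theorem val_infinityPlace (f : CurveField K) :
    (infinityPlace K).val f = (origin K).valuation (CurveField K) (inversion K f) := by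
  have h := Place.val_eq (infinityPlace K)
    (((origin K).valuation (CurveField K)).comap (inversion K).toRingEquiv.toRingHom)
    ((HeightOneSpectrum.valuation_surjective _ _).comp (inversion K).surjective) rfl
  rw [h]
  rfl

theorem valuation_origin_curveX :
    (origin K).valuation (CurveField K) (curveX K) = exp (-1) := by
  rw [← intValuation_origin_curveRingX (K := K),
    ← HeightOneSpectrum.valuation_of_algebraMap (K := CurveField K)]
  rfl

theorem valuation_origin_curveY :
    (origin K).valuation (CurveField K) (curveY K) = exp (-2) := by
  rw [← algebraMap_X_curveField, IsScalarTower.algebraMap_apply K[X] (curveRing K) (CurveField K),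
    HeightOneSpectrum.valuation_of_algebraMap, intValuation_origin_X,
    intValuation_origin_curveRingX]
  rfl

theorem val_infinityPlace_curveX : (infinityPlace K).val (curveX K) = exp 5 := by
  rw [val_infinityPlace, inversion_curveX, map_div₀, map_pow, valuation_origin_curveX,
    valuation_origin_curveY]
  rfl

theorem val_infinityPlace_curveY : (infinityPlace K).val (curveY K) = exp 2 := by
  rw [val_infinityPlace, inversion_curveY, map_inv₀, valuation_origin_curveY]
  rfl

theorem curveY_not_mem_infinityPlace : curveY K ∉ (infinityPlace K).ring := by
  rw [← Place.val_le_one_iff, val_infinityPlace_curveY, not_le, ← WithZero.exp_zero,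
    WithZero.exp_lt_exp]
  norm_num

theorem degree_infinityPlace : (infinityPlace K).degree = 1 := by
  rw [infinityPlace,
    degree_comap_placeOfPrime irreducible_X X_mem_origin curveRingX_sub_mem_origin, natDegree_X]

/-- After the inversion y vanishes at the centre, hence so does x, and only the origin has this
property. -/
theorem eq_infinityPlace {P : Place K (CurveField K)} (hP : curveY K ∉ P.ring) :
    P = infinityPlace K := by
  obtain ⟨v, hv⟩ := exists_eq_placeOfPrime_of_curveY_mem (curveY_mem_comap_inversion hP)
  have hX : algebraMap K[X] _ X ∈ v.asIdeal := by
    rw [← HeightOneSpectrum.valuation_lt_one_iff_mem (K := CurveField K),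
      ← placeOfPrime_valuation_lt_one_iff (K := K), ← hv, Place.comap_valuation_lt_one_iff]
    change P.ring.valuation (inversion K (algebraMap K[X] (CurveField K) X)) < 1
    rw [algebraMap_X_curveField, inversion_curveY,
      Place.valuation_lt_one_iff_inv, inv_inv]
    exact Or.inr hP
  have hx : curveRingX K ∈ v.asIdeal := by
    refine v.isPrime.mem_of_pow_mem 2 ?_
    rw [curveRingX_sq, show curveRHS K = (X ^ 4 + 1) * X by ring, map_mul]
    exact Ideal.mul_mem_left _ _ hX
  have hvo : v = origin K := prime_eq_of_mem irreducible_X hX (s := 0) (by simpa using hx)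
    X_mem_origin curveRingX_sub_mem_origin
  rw [infinityPlace, ← hvo, ← hv, Place.comap_comap, inversion_trans_self, Place.comap_refl]

theorem eq_infinityPlace_or (P : Place K (CurveField K)) :
    P = infinityPlace K ∨
    ∃ v : HeightOneSpectrum (curveRing K), P = placeOfPrime K (CurveField K) v := by
  by_cases hP : curveY K ∈ P.ring
  · exact Or.inr (exists_eq_placeOfPrime_of_curveY_mem hP)
  · exact Or.inl (eq_infinityPlace hP)

theorem placeOfPrime_ne_infinityPlace (v : HeightOneSpectrum (curveRing K)) :
    placeOfPrime K (CurveField K) v ≠ infinityPlace K := fun h =>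
  curveY_not_mem_infinityPlace (h ▸ curveY_mem_placeOfPrime v)

theorem val_infinityPlace_algebraMap {p : K[X]} (hp : p ≠ 0) :
    (infinityPlace K).val (algebraMap K[X] _ p) = exp (2 * p.natDegree : ℤ) := by
  have hterm : ∀ (a : K) (i : ℕ), a ≠ 0 →
      (infinityPlace K).val (a • curveY K ^ i) = exp (2 * i : ℤ) := fun a i ha => by
    rw [Algebra.smul_def, map_mul, Place.val_algebraMap _ ha, one_mul, map_pow,
      val_infinityPlace_curveY, ← WithZero.exp_nsmul, nsmul_eq_mul, mul_comm]
  rw [algebraMap_eq_aeval, aeval_eq_sum_range, Finset.sum_range_succ]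
  have hl := hterm p.leadingCoeff p.natDegree (leadingCoeff_ne_zero.2 hp)
  rw [← hl]
  refine Valuation.map_add_eq_of_lt_right (infinityPlace K).val ?_
  change _ < (infinityPlace K).val (p.leadingCoeff • curveY K ^ p.natDegree)
  rw [hl]
  refine Valuation.map_sum_lt _ WithZero.exp_ne_zero fun i hi => ?_
  rcases eq_or_ne (p.coeff i) 0 with h0 | h0
  · simp [h0]
  · rw [hterm _ _ h0, WithZero.exp_lt_exp]
    have := Finset.mem_range.1 hi
    omega

theorem val_infinityPlace_algebraMap_le_iff {p : K[X]} {n : ℤ} :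
    (infinityPlace K).val (algebraMap K[X] _ p) ≤ exp n ↔ p = 0 ∨ (2 * p.natDegree : ℤ) ≤ n := by
  rcases eq_or_ne p 0 with rfl | hp
  · simp
  · simp [val_infinityPlace_algebraMap hp, hp]

theorem val_infinityPlace_mul_curveX_le_iff {p : K[X]} {n : ℤ} :
    (infinityPlace K).val (algebraMap K[X] _ p * curveX K) ≤ exp n ↔
      p = 0 ∨ (2 * p.natDegree : ℤ) + 5 ≤ n := by
  rcases eq_or_ne p 0 with rfl | hp
  · simp
  · rw [map_mul, val_infinityPlace_algebraMap hp, val_infinityPlace_curveX, ← WithZero.exp_add,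
      WithZero.exp_le_exp]
    simp [hp]

/-- The pole orders 2 deg a and 2 deg b + 5 have different parity, so the two terms cannot cancel.
-/
theorem val_infinityPlace_add_le_iff {a b : K[X]} {n : ℤ} :
    (infinityPlace K).val (algebraMap K[X] _ a + algebraMap K[X] _ b * curveX K) ≤ exp n ↔
      (a = 0 ∨ (2 * a.natDegree : ℤ) ≤ n) ∧ (b = 0 ∨ (2 * b.natDegree : ℤ) + 5 ≤ n) := by
  rw [← val_infinityPlace_algebraMap_le_iff, ← val_infinityPlace_mul_curveX_le_iff]
  rcases eq_or_ne a 0 with rfl | ha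
  · simp
  rcases eq_or_ne b 0 with rfl | hb
  · simp
  rw [Valuation.map_add_of_distinct_val, max_le_iff]
  rw [map_mul, val_infinityPlace_algebraMap ha, val_infinityPlace_algebraMap hb,
    val_infinityPlace_curveX, ← WithZero.exp_add, Ne, WithZero.exp_inj]
  omega

theorem mem_riemannRochSpace_infinityPlace {n : ℤ} {f : CurveField K} :
    f ∈ riemannRochSpace (Finsupp.single (infinityPlace K) n) ↔
      ∃ a b : K[X], f = algebraMap K[X] _ a + algebraMap K[X] _ b * curveX K ∧
        (a = 0 ∨ (2 * a.natDegree : ℤ) ≤ n) ∧ (b = 0 ∨ (2 * b.natDegree : ℤ) + 5 ≤ n) := by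
  classical
  rw [mem_riemannRochSpace]
  constructor
  · intro h
    have hf : f ∈ (algebraMap (curveRing K) (CurveField K)).range := by
      refine HeightOneSpectrum.mem_integers_of_valuation_le_one _ f fun v => ?_
      have := h (placeOfPrime K _ v)
      rwa [Finsupp.single_eq_of_ne (placeOfPrime_ne_infinityPlace v), val_placeOfPrime,
        WithZero.exp_zero] at this
    obtain ⟨r, rfl⟩ := hf
    obtain ⟨a, b, hr⟩ := mem_curveRing_iff.1 r.2
    have hr' : algebraMap (curveRing K) (CurveField K) r = _ := hr
    refine ⟨a, b, hr', ?_⟩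
    rw [← val_infinityPlace_add_le_iff, ← hr']
    simpa using h (infinityPlace K)
  · rintro ⟨a, b, rfl, h⟩ P
    rcases eq_infinityPlace_or P with rfl | ⟨v, rfl⟩
    · rw [Finsupp.single_eq_same, val_infinityPlace_add_le_iff]
      exact h
    · rw [Finsupp.single_eq_of_ne (placeOfPrime_ne_infinityPlace v), WithZero.exp_zero,
        Place.val_le_one_iff]
      have := curveY_mem_placeOfPrime v
      exact add_mem (algebraMap_mem_of_curveY_mem this a)
        (mul_mem (algebraMap_mem_of_curveY_mem this b) (curveX_mem_of_curveY_mem this))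

variable (K) in
/-- The map `(a, b) ↦ a + b x`. -/
def coordMap (k : ℕ) : degreeLT K (k + 3) × degreeLT K k →ₗ[K] CurveField K :=
  let ψ := ((Algebra.ofId K[X] (CurveField K)).restrictScalars K).toLinearMap
  LinearMap.coprod (ψ ∘ₗ Submodule.subtype _)
    (LinearMap.mulRight K (curveX K) ∘ₗ ψ ∘ₗ Submodule.subtype _)

omit [CharP K 5] in
theorem coordMap_apply (k : ℕ) (a : degreeLT K (k + 3)) (b : degreeLT K k) : coordMap K k (a, b) =
    algebraMap K[X] _ (a : K[X]) + algebraMap K[X] _ (b : K[X]) * curveX K := rfl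

omit [CharP K 5] in
theorem mem_degreeLT_iff {p : K[X]} {n : ℕ} : p ∈ degreeLT K n ↔ p = 0 ∨ p.natDegree < n := by
  rw [mem_degreeLT]
  rcases eq_or_ne p 0 with rfl | hp
  · simp
  · simp [hp, natDegree_lt_iff_degree_lt hp]

/-- A pole of order at most 2k + 4 allows deg a ≤ k + 2 and deg b ≤ k - 1, that is, k + 3 and k
coefficients. -/
theorem range_coordMap (k : ℕ) : LinearMap.range (coordMap K k) =
    riemannRochSpace (Finsupp.single (infinityPlace K) (2 * k + 4 : ℤ)) := by
  ext f
  rw [mem_riemannRochSpace_infinityPlace, LinearMap.mem_range]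
  constructor
  · rintro ⟨⟨⟨a, ha⟩, b, hb⟩, rfl⟩
    refine ⟨a, b, rfl, (mem_degreeLT_iff.1 ha).imp_right ?_, (mem_degreeLT_iff.1 hb).imp_right ?_⟩
      <;> omega
  · rintro ⟨a, b, rfl, ha, hb⟩
    refine ⟨(⟨a, mem_degreeLT_iff.2 (ha.imp_right ?_)⟩, ⟨b, mem_degreeLT_iff.2 (hb.imp_right ?_)⟩),
      rfl⟩ <;> omega

omit [CharP K 5] in
theorem coordMap_injective (k : ℕ) : Function.Injective (coordMap K k) := by
  rw [← LinearMap.ker_eq_bot, LinearMap.ker_eq_bot']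
  rintro ⟨⟨a, ha⟩, b, hb⟩ h
  rw [coordMap_apply] at h
  obtain ⟨h1, h2⟩ := polynomial_add_mul_curveX_eq_zero h
  simp only at h1 h2
  subst h1 h2
  rfl

instance (n : ℕ) : Module.Finite K (degreeLT K n) := Module.Finite.equiv (degreeLTEquiv K n).symm

theorem ell_infinityPlace (k : ℕ) :
    ell (Finsupp.single (infinityPlace K) (2 * k + 4 : ℤ)) = 2 * k + 3 := by
  have h : ∀ n, Module.finrank K (degreeLT K n) = n := fun n => by
    rw [(degreeLTEquiv K n).finrank_eq, Module.finrank_fin_fun]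
  unfold ell
  rw [← range_coordMap, LinearMap.finrank_range_of_inj (coordMap_injective k),
    Module.finrank_prod, h, h]
  omega

instance finite_constants : Module.Finite K (riemannRochSpace (0 : Divisor K (CurveField K))) := by
  have h : Module.Finite K
      (riemannRochSpace (Finsupp.single (infinityPlace K) (2 * (0 : ℕ) + 4 : ℤ))) := by
    rw [← range_coordMap]
    infer_instance
  have h0 : (0 : Divisor K (CurveField K)) ≤
      Finsupp.single (infinityPlace K) (2 * (0 : ℕ) + 4 : ℤ) := Finsupp.single_nonneg.2 (by simp)
  exact Submodule.finiteDimensional_of_le (riemannRochSpace_mono h0)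

/-- For odd n, compare with n + 1: one rational place changes ℓ by at most 1. -/
theorem le_ell_infinityPlace {n : ℕ} (hn : 4 ≤ n) :
    (n : ℤ) - 1 ≤ ell (Finsupp.single (infinityPlace K) (n : ℤ)) := by
  rcases Nat.even_or_odd' n with ⟨m, rfl | rfl⟩
  · have := ell_infinityPlace (K := K) (m - 2)
    rw [show (2 * (m - 2 : ℕ) + 4 : ℤ) = (2 * m : ℕ) by omega] at this
    omega
  · have h1 := ell_infinityPlace (K := K) (m - 1)
    rw [show (2 * (m - 1 : ℕ) + 4 : ℤ) = (2 * m + 1 : ℕ) + 1 by omega, Finsupp.single_add] at h1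
    have h2 := (finite_and_ell_add_single (Finsupp.single (infinityPlace K) ((2 * m + 1 : ℕ) : ℤ))
      (infinityPlace K) inferInstance).2
    rw [degree_infinityPlace] at h2
    omega

variable [Finite K]

/-- When a finite place P is added to E, every residue class at P must come from a function in the
larger space. Regular lifts of the classes, multiplied by a power of a function whose only finite
pole is a simple one at P, do this; their poles at infinity are absorbed by taking n large. -/
theorem exists_le_ell_add (E : Divisor K (CurveField K)) (hE : 0 ≤ E) : ∃ n₀ : ℕ, ∀ n : ℕ,
    n₀ ≤ n → E.degree + n - 1 ≤ ell (E + Finsupp.single (infinityPlace K) (n : ℤ)) := by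
  classical
  refine Divisor.effective_induction (p := fun E => ∃ n₀ : ℕ, ∀ n : ℕ, n₀ ≤ n →
    E.degree + n - 1 ≤ ell (E + Finsupp.single (infinityPlace K) (n : ℤ))) ?_ ?_ E hE
  · refine ⟨4, fun n hn => ?_⟩
    rw [Divisor.degree_zero, zero_add, zero_add]
    exact le_ell_infinityPlace hn
  · rintro E P hE ⟨n₀, hn₀⟩
    rcases eq_infinityPlace_or P with rfl | ⟨v, rfl⟩
    · refine ⟨n₀, fun n hn => ?_⟩
      -- Adding the place at infinity to E only shifts n by one.
      have := hn₀ (n + 1) (by omega)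
      rw [Divisor.degree_add, Divisor.degree_single, degree_infinityPlace,
        add_assoc E, ← Finsupp.single_add, add_comm (1 : ℤ)]
      push_cast at this ⊢
      linarith
    set P := placeOfPrime K (CurveField K) v with hP
    obtain ⟨h, hv, hw⟩ := exists_valuation_eq_exp_one (F := CurveField K) v
    have hvP : P.val h = exp 1 := by rw [hP, val_placeOfPrime, hv]
    have hne : P ≠ infinityPlace K := placeOfPrime_ne_infinityPlace v
    obtain ⟨k, hk⟩ := Int.eq_ofNat_of_zero_le (hE P)
    have hk' : E P = k := hk
    have hreg : ∀ r : curveRing K, algebraMap (curveRing K) (CurveField K) r ∈ P.ring :=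
      algebraMap_mem_placeOfPrime v
    have hlift : ∀ ρ : IsLocalRing.ResidueField P.ring, ∃ r : curveRing K,
        IsLocalRing.residue P.ring ⟨algebraMap (curveRing K) (CurveField K) r, hreg r⟩ = ρ := by
      intro ρ
      obtain ⟨f, rfl⟩ := IsLocalRing.residue_surjective ρ
      obtain ⟨r, hr⟩ := exists_algebraMap_sub_lt_one v f.2
      refine ⟨r, ?_⟩
      rw [← sub_eq_zero, ← map_sub, IsLocalRing.residue_eq_zero_iff,
        ValuationSubring.valuation_lt_one_iff]
      exact hr
    choose r hr using hlift
    -- Finitely many residue classes need lifting, so one n₁ bounds all the poles at infinity.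
    have : Finite (IsLocalRing.ResidueField P.ring) := Module.finite_of_finite K
    have hbound : ∃ n₁ : ℕ, ∀ ρ, (infinityPlace K).val
        (h ^ (k + 1) * algebraMap (curveRing K) (CurveField K) (r ρ)) ≤ exp (n₁ : ℤ) := by
      have h1 : ∀ f : CurveField K, ∃ n : ℕ, (infinityPlace K).val f ≤ exp (n : ℤ) := fun f => by
        rcases eq_or_ne f 0 with rfl | hf
        · exact ⟨0, by simp⟩
        · obtain ⟨m, hm⟩ := (infinityPlace K).exists_val_eq_exp hf
          exact ⟨m.toNat, by rw [hm, WithZero.exp_le_exp]; exact Int.self_le_toNat m⟩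
      choose N hN using fun ρ => h1 (h ^ (k + 1) * algebraMap (curveRing K) (CurveField K) (r ρ))
      have := Fintype.ofFinite (IsLocalRing.ResidueField P.ring)
      refine ⟨Finset.univ.sup N, fun ρ => (hN ρ).trans (WithZero.exp_le_exp.2 ?_)⟩
      exact_mod_cast Finset.le_sup (Finset.mem_univ ρ)
    obtain ⟨n₁, hn₁⟩ := hbound
    refine ⟨max n₀ n₁, fun n hn => ?_⟩
    have hstep := hn₀ n (le_of_max_le_left hn)
    set A := E + Finsupp.single (infinityPlace K) (n : ℤ) with hA
    have hAP : (A + Finsupp.single P 1 : Divisor K (CurveField K)) P = k + 1 := by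
      simp [hA, hk', hne.symm]
    have hh0 : h ≠ 0 := fun h0 => by
      rw [h0, map_zero] at hv
      exact WithZero.exp_ne_zero hv.symm
    have hu : P.val (h ^ (k + 1))⁻¹ =
        exp (-((A + Finsupp.single P 1 : Divisor K (CurveField K)) P)) := by
      rw [hAP, map_inv₀, map_pow, hvP, ← WithZero.exp_nsmul, ← WithZero.exp_neg]
      simp
    have hmem : ∀ ρ, h ^ (k + 1) * algebraMap (curveRing K) (CurveField K) (r ρ) ∈
        riemannRochSpace (A + Finsupp.single P 1) := by
      intro ρ
      rw [mem_riemannRochSpace]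
      intro Q
      rcases eq_infinityPlace_or Q with rfl | ⟨w, rfl⟩
      · refine (hn₁ ρ).trans (WithZero.exp_le_exp.2 ?_)
        have h1 : 0 ≤ E (infinityPlace K) := hE _
        have h2 : n₁ ≤ n := le_of_max_le_right hn
        simp only [hA, Finsupp.add_apply, Finsupp.single_eq_same,
          Finsupp.single_eq_of_ne hne.symm]
        omega
      · have hr1 : (placeOfPrime K (CurveField K) w).val
            (algebraMap (curveRing K) (CurveField K) (r ρ)) ≤ 1 :=
          (Place.val_le_one_iff _).2 (algebraMap_mem_placeOfPrime w _)
        rw [map_mul]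
        refine (mul_le_of_le_one_right' hr1).trans ?_
        rcases eq_or_ne w v with rfl | hwv
        · rw [← hP, hAP, map_pow, hvP, ← WithZero.exp_nsmul]
          simp
        · have hw1 : (placeOfPrime K (CurveField K) w).val (h ^ (k + 1)) ≤ 1 := by
            rw [map_pow, val_placeOfPrime]
            exact pow_le_one' (hw w hwv) _
          refine hw1.trans ?_
          rw [← WithZero.exp_zero, WithZero.exp_le_exp]
          have h1 : 0 ≤ E (placeOfPrime K (CurveField K) w) := hE _
          have h2 : 0 ≤ (Finsupp.single P 1 : Divisor K (CurveField K))
              (placeOfPrime K (CurveField K) w) := Finsupp.single_nonneg.2 zero_le_one _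
          simp only [hA, Finsupp.add_apply,
            Finsupp.single_eq_of_ne (placeOfPrime_ne_infinityPlace w)]
          omega
    have hs : Function.Surjective (residueMap _ P _ hu) := by
      intro ρ
      refine ⟨⟨_, hmem ρ⟩, ?_⟩
      conv_rhs => rw [← hr ρ]
      rw [residueMap_eq_iff]
      have : h ^ (k + 1) * algebraMap (curveRing K) (CurveField K) (r ρ) * (h ^ (k + 1))⁻¹ =
          algebraMap (curveRing K) (CurveField K) (r ρ) := by
        field_simp
      rw [this, sub_self, map_zero]
      exact zero_lt_one
    have hfin := ell_add_single_of_surjective A P inferInstance _ hu hs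
    have hcomm : E + Finsupp.single P 1 + Finsupp.single (infinityPlace K) (n : ℤ) =
        A + Finsupp.single P 1 := add_right_comm _ _ _
    rw [hcomm, ← hfin, Divisor.degree_add, Divisor.degree_single]
    push_cast
    linarith

/-- A lies below some (A ⊔ 0) + n∞ where the inequality is known, and descending to A lowers ℓ by at
most the degree lost. -/
theorem degree_sub_one_le_ell (A : Divisor K (CurveField K)) : A.degree - 1 ≤ ell A := by
  classical
  obtain ⟨n, hn⟩ := exists_le_ell_add (A ⊔ 0) le_sup_right
  have h1 := hn n le_rfl
  have h2 : A ≤ A ⊔ 0 + Finsupp.single (infinityPlace K) (n : ℤ) :=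
    le_sup_left.trans (le_add_of_nonneg_right (Finsupp.single_nonneg.2 (by simp)))
  have h3 := ell_le_of_le h2
  rw [Divisor.degree_add, Divisor.degree_single, degree_infinityPlace] at h3
  push_cast at h3
  linarith

variable (K) in
theorem hasGenus_curveField : HasGenus K (CurveField K) 2 := by
  constructor
  -- The divisor 4∞ has ℓ = 3 and attains the maximum 4 - 3 + 1 = 2.
  · refine ⟨Finsupp.single (infinityPlace K) (2 * (0 : ℕ) + 4 : ℤ), ?_⟩
    have := ell_infinityPlace (K := K) 0
    simp only [Divisor.degree_single, degree_infinityPlace]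
    unfold ell at this
    rw [this]
    norm_num
  · rintro _ ⟨A, rfl⟩
    have := degree_sub_one_le_ell A
    unfold ell at this
    simp only
    push_cast
    linarith

end Infinity

/-! ### Values of functions at rational places. -/

section RationalPlace

variable {K F : Type*} [Field K] [Field F] [Algebra K F]

theorem Place.exists_valuation_sub_lt_one {P : Place K F} (hP : P.degree = 1) {f : F}
    (hf : f ∈ P.ring) : ∃ c : K, P.ring.valuation (f - algebraMap K F c) < 1 := by
  obtain ⟨c, hc⟩ := (finrank_eq_one_iff_of_nonzero' (1 : IsLocalRing.ResidueField P.ring)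
    one_ne_zero).1 hP (IsLocalRing.residue P.ring ⟨f, hf⟩)
  refine ⟨c, ?_⟩
  rw [← Algebra.algebraMap_eq_smul_one, IsScalarTower.algebraMap_apply K P.ring, ← sub_eq_zero,
    IsLocalRing.ResidueField.algebraMap_eq, ← map_sub, IsLocalRing.residue_eq_zero_iff,
    ValuationSubring.valuation_lt_one_iff] at hc
  rw [Valuation.map_sub_swap]
  exact hc

theorem Place.eq_of_valuation_sub_lt_one {P : Place K F} {f : F} {c d : K}
    (hc : P.ring.valuation (f - algebraMap K F c) < 1)
    (hd : P.ring.valuation (f - algebraMap K F d) < 1) : c = d := by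
  by_contra hne
  have h1 : P.ring.valuation (algebraMap K F (c - d)) < 1 := by
    have : algebraMap K F (c - d) = (f - algebraMap K F d) - (f - algebraMap K F c) := by
      rw [map_sub]
      ring
    rw [this]
    exact (Valuation.map_sub _ _ _).trans_lt (max_lt hd hc)
  have h2 := P.valuation_algebraMap_le (c - d)⁻¹
  have h3 : P.ring.valuation (algebraMap K F (c - d) * algebraMap K F (c - d)⁻¹) < 1 := by
    rw [map_mul]
    exact (mul_le_of_le_one_right' h2).trans_lt h1
  rw [← map_mul, mul_inv_cancel₀ (sub_ne_zero.2 hne), map_one, map_one] at h3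
  exact lt_irrefl _ h3

end RationalPlace

/-! ### The quadratic extension over K(y). -/

section Hyperelliptic

variable (K : Type*) [Field K]

theorem finrank_adjoin_curveY :
    Module.finrank (IntermediateField.adjoin K {curveY K}) (CurveField K) = 2 := by
  let f : RatFunc K →ₐ[K] CurveField K :=
    (Algebra.ofId (RatFunc K) (CurveField K)).restrictScalars K
  have hf : f.fieldRange = IntermediateField.adjoin K {curveY K} := by
    rw [AlgHom.fieldRange_eq_map, ← RatFunc.adjoin_X,
      IntermediateField.adjoin_map, Set.image_singleton]
    rfl
  rw [← hf, ← finrank_curveField K]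
  exact (Algebra.finrank_eq_of_equiv_equiv (AlgEquiv.ofInjectiveField f).toRingEquiv
    (RingEquiv.refl _) rfl).symm

theorem isHyperelliptic_curveField [CharP K 5] [Finite K] : IsHyperelliptic K (CurveField K) :=
  ⟨⟨2, le_rfl, hasGenus_curveField K⟩, curveY K, transcendental_curveY, finrank_adjoin_curveY K⟩

end Hyperelliptic

/-! ### The exact value of ℓ in degree at least three. -/

section Nonspecial

variable {K : Type*} [Field K] [CharP K 5]

theorem val_algebraMap_lt_one_iff {v : HeightOneSpectrum (curveRing K)} {p s : K[X]}
    (hp : Irreducible p) (h1 : algebraMap K[X] _ p ∈ v.asIdeal)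
    (h2 : curveRingX K - algebraMap K[X] _ s ∈ v.asIdeal) (q : K[X]) :
    (placeOfPrime K (CurveField K) v).val (algebraMap K[X] _ q) < 1 ↔ p ∣ q := by
  rw [val_placeOfPrime, IsScalarTower.algebraMap_apply K[X] (curveRing K) (CurveField K),
    HeightOneSpectrum.valuation_lt_one_iff_mem]
  simpa using mem_prime_iff hp h1 h2 q 0

theorem val_algebraMap_le_one (v : HeightOneSpectrum (curveRing K)) (q : K[X]) :
    (placeOfPrime K (CurveField K) v).val (algebraMap K[X] _ q) ≤ 1 :=
  (Place.val_le_one_iff _).2 (algebraMap_mem_of_curveY_mem (curveY_mem_placeOfPrime v) q)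

theorem val_algebraMap_eq_one {v : HeightOneSpectrum (curveRing K)} {p s : K[X]}
    (hp : Irreducible p) (h1 : algebraMap K[X] _ p ∈ v.asIdeal)
    (h2 : curveRingX K - algebraMap K[X] _ s ∈ v.asIdeal) {q : K[X]} (hq : ¬ p ∣ q) :
    (placeOfPrime K (CurveField K) v).val (algebraMap K[X] _ q) = 1 :=
  le_antisymm (val_algebraMap_le_one v q)
    (not_lt.1 fun h => hq ((val_algebraMap_lt_one_iff hp h1 h2 q).1 h))

theorem exists_coords {v : HeightOneSpectrum (curveRing K)}
    (hv : (placeOfPrime K (CurveField K) v).degree = 1) : ∃ α β : K,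
      algebraMap K[X] _ (X - C β) ∈ v.asIdeal ∧
      curveRingX K - algebraMap K[X] _ (C α) ∈ v.asIdeal := by
  have hy := curveY_mem_placeOfPrime v
  obtain ⟨β, hβ⟩ := Place.exists_valuation_sub_lt_one hv hy
  obtain ⟨α, hα⟩ := Place.exists_valuation_sub_lt_one hv (curveX_mem_of_curveY_mem hy)
  refine ⟨α, β, ?_, ?_⟩
  · rw [← HeightOneSpectrum.valuation_lt_one_iff_mem (K := CurveField K),
      ← placeOfPrime_valuation_lt_one_iff (K := K)]
    change (placeOfPrime K _ v).ring.valuation (algebraMap K[X] (CurveField K) (X - C β)) < 1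
    rwa [map_sub, algebraMap_X_curveField, algebraMap_C_curveField]
  · rw [← HeightOneSpectrum.valuation_lt_one_iff_mem (K := CurveField K),
      ← placeOfPrime_valuation_lt_one_iff (K := K)]
    change (placeOfPrime K _ v).ring.valuation
      (curveX K - algebraMap K[X] (CurveField K) (C α)) < 1
    rwa [algebraMap_C_curveField]

omit [CharP K 5] in
theorem dvd_curveRHS_sub_sq {v : HeightOneSpectrum (curveRing K)} {p s : K[X]}
    (hp : Irreducible p) (h1 : algebraMap K[X] _ p ∈ v.asIdeal)
    (h2 : curveRingX K - algebraMap K[X] _ s ∈ v.asIdeal) : p ∣ curveRHS K - s ^ 2 := by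
  have h3 : algebraMap K[X] (curveRing K) (curveRHS K - s ^ 2) ∈ v.asIdeal := by
    rw [map_sub, ← curveRingX_sq, map_pow, sq_sub_sq]
    exact Ideal.mul_mem_left _ _ h2
  simpa using (mem_prime_iff hp h1 h2 (curveRHS K - s ^ 2) 0).1 (by simpa using h3)

/-- If a prime over `y - β` is the only one, it is ramified. -/
theorem val_le_of_forall_prime_eq {v : HeightOneSpectrum (curveRing K)} {α β : K}
    (hβ : algebraMap K[X] _ (X - C β) ∈ v.asIdeal)
    (hα : curveRingX K - algebraMap K[X] _ (C α) ∈ v.asIdeal)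
    (hα' : curveRingX K - algebraMap K[X] _ (C (-α)) ∈ v.asIdeal) :
    (placeOfPrime K (CurveField K) v).val (algebraMap K[X] _ (X - C β)) ≤ exp (-2) := by
  have hpi : Irreducible (X - C β) := irreducible_X_sub_C β
  -- Both x - α and x + α lie in v, so 2α does too, which forces α = 0.
  have h2α : X - C β ∣ C (2 * α) := by
    have h1 : algebraMap K[X] (curveRing K) (C (2 * α)) ∈ v.asIdeal := by
      have h3 := v.asIdeal.sub_mem hα' hα
      have h4 : curveRingX K - algebraMap K[X] (curveRing K) (C (-α)) -
          (curveRingX K - algebraMap K[X] (curveRing K) (C α)) =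
          algebraMap K[X] (curveRing K) (C (2 * α)) := by
        rw [sub_sub_sub_cancel_left, ← map_sub, ← C_sub]
        congr 2
        ring
      rwa [h4] at h3
    simpa using (mem_prime_iff hpi hβ hα (C (2 * α)) 0).1 (by simpa using h1)
  have hα0 : α = 0 := by
    by_contra hα0
    exact hpi.not_isUnit (isUnit_of_dvd_unit h2α
      (isUnit_C.2 (mul_ne_zero two_ne_zero_of_charP_five hα0).isUnit))
  subst hα0
  obtain ⟨h, hh⟩ := dvd_curveRHS_sub_sq hpi hβ hα
  rw [C_0, zero_pow two_ne_zero, sub_zero] at hh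
  -- The root β of y^5 + y is simple because the derivative is 1; so y - β has the order of x² at v.
  have hph : ¬ X - C β ∣ h := by
    have h1 := congrArg (eval β) (congrArg derivative hh)
    rw [derivative_curveRHS] at h1
    simp only [eval_one, derivative_mul, derivative_X_sub_C, one_mul, eval_add, eval_mul,
      eval_sub, eval_X, eval_C, sub_self, zero_mul, add_zero] at h1
    rw [dvd_iff_isRoot, IsRoot.def, ← h1]
    exact one_ne_zero
  have hx1 : (placeOfPrime K (CurveField K) v).val (curveX K) < 1 := by
    rw [C_0, map_zero, sub_zero] at hα
    have h1 : algebraMap (curveRing K) (CurveField K) (curveRingX K) = curveX K := rfl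
    rw [val_placeOfPrime, ← h1, HeightOneSpectrum.valuation_lt_one_iff_mem]
    exact hα
  have h2 : (placeOfPrime K (CurveField K) v).val (algebraMap K[X] _ (X - C β)) =
      (placeOfPrime K (CurveField K) v).val (curveX K) ^ 2 := by
    rw [← map_pow, curveX_sq, hh, map_mul, map_mul, val_algebraMap_eq_one hpi hβ hα hph, mul_one]
  rw [h2]
  rw [← WithZero.exp_zero, Place.lt_exp_iff] at hx1
  exact pow_le_pow_left' hx1 2

/-- The functions with at most a pole of order two at infinity and a simple pole at a rational
place are the linear polynomials in `y`. -/
theorem exists_eq_of_mem_single_add {P : Place K (CurveField K)} (hP : P.degree = 1)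
    {f : CurveField K}
    (hf : f ∈ riemannRochSpace (Finsupp.single P 1 + Finsupp.single (infinityPlace K) 2)) :
    ∃ q : K[X], q.natDegree ≤ 1 ∧ f = algebraMap K[X] _ q := by
  classical
  rcases eq_infinityPlace_or P with rfl | ⟨v, rfl⟩
  · rw [← Finsupp.single_add, mem_riemannRochSpace_infinityPlace] at hf
    obtain ⟨a, b, rfl, ha, hb⟩ := hf
    obtain rfl : b = 0 := hb.resolve_right (by omega)
    refine ⟨a, ?_, by simp⟩
    rcases ha with rfl | ha
    · simp
    · omega
  obtain ⟨α, β, hβ, hα⟩ := exists_coords hP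
  set p : K[X] := X - C β with hp
  have hpi : Irreducible p := irreducible_X_sub_C β
  set P := placeOfPrime K (CurveField K) v with hPdef
  have hPi : P ≠ infinityPlace K := placeOfPrime_ne_infinityPlace v
  have hfP : P.val f ≤ exp 1 := by
    simpa [hPi] using mem_riemannRochSpace.1 hf P
  have hfQ : ∀ w : HeightOneSpectrum (curveRing K),
      placeOfPrime K (CurveField K) w ≠ P → (placeOfPrime K (CurveField K) w).val f ≤ 1 := by
    intro w hw
    simpa [hw, placeOfPrime_ne_infinityPlace w] using
      mem_riemannRochSpace.1 hf (placeOfPrime K (CurveField K) w)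
  have hpP : P.val (algebraMap K[X] _ p) < 1 := (val_algebraMap_lt_one_iff hpi hβ hα p).2 dvd_rfl
  have hp0 : algebraMap K[X] (CurveField K) p ≠ 0 :=
    (map_ne_zero_iff _ (algebraMap_curveField_injective K)).2 hpi.ne_zero
  -- Multiplying by y - β clears the pole at P and gives a pole of order at most 4 at infinity. As x
  -- has a pole of order 5 there, no x-term survives.
  have hg : f * algebraMap K[X] _ p ∈
      riemannRochSpace (Finsupp.single (infinityPlace K) (4 : ℤ)) := by
    rw [mem_riemannRochSpace]
    intro Q
    rw [map_mul]
    rcases eq_infinityPlace_or Q with rfl | ⟨w, rfl⟩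
    · have h1 := mem_riemannRochSpace.1 hf (infinityPlace K)
      rw [Finsupp.add_apply, Finsupp.single_eq_of_ne hPi.symm, Finsupp.single_eq_same,
        zero_add] at h1
      rw [val_infinityPlace_algebraMap hpi.ne_zero, hp, natDegree_X_sub_C,
        Finsupp.single_eq_same]
      exact mul_le_mul' h1 le_rfl
    · rw [Finsupp.single_eq_of_ne (placeOfPrime_ne_infinityPlace w), WithZero.exp_zero]
      by_cases hw : placeOfPrime K (CurveField K) w = P
      · rw [hw]
        rw [← WithZero.exp_zero, Place.lt_exp_iff] at hpP
        exact (mul_le_mul' hfP hpP).trans_eq rfl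
      · exact mul_le_one' (hfQ w hw) (val_algebraMap_le_one w p)
  obtain ⟨a, b, hab, ha, hb⟩ := mem_riemannRochSpace_infinityPlace.1 hg
  obtain rfl : b = 0 := hb.resolve_right (by omega)
  rw [map_zero, zero_mul, add_zero] at hab
  by_cases hpa : p ∣ a
  · obtain ⟨q, rfl⟩ := hpa
    refine ⟨q, ?_, ?_⟩
    · rcases ha with ha | ha
      · rw [mul_eq_zero] at ha
        rw [ha.resolve_left hpi.ne_zero]
        simp
      · rcases eq_or_ne q 0 with rfl | hq
        · simp
        rw [natDegree_mul hpi.ne_zero hq, hp, natDegree_X_sub_C] at ha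
        push_cast at ha
        omega
    · rw [map_mul, mul_comm] at hab
      exact mul_left_cancel₀ hp0 hab
  exfalso
  -- If y - β does not divide a, then f = a/(y - β) also has a pole at the conjugate prime w = (y -
  -- β, x + α). For w different from v this pole is forbidden; for w = v ramification makes the pole
  -- at least double.
  obtain ⟨w, hw1, hw2⟩ := exists_prime_of_dvd (K := K) (p := p) (s := C (-α)) hpi.not_isUnit
    (by simpa using dvd_curveRHS_sub_sq hpi hβ hα)
  by_cases hw : placeOfPrime K (CurveField K) w = P
  · have hwv : ∀ r : curveRing K, r ∈ w.asIdeal → r ∈ v.asIdeal := fun r hr => by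
      rw [← HeightOneSpectrum.valuation_lt_one_iff_mem (K := CurveField K),
        ← placeOfPrime_valuation_lt_one_iff (K := K)] at hr ⊢
      rwa [hw] at hr
    have h3 : P.val (f * algebraMap K[X] _ p) ≤ exp (1 : ℤ) * exp (-2 : ℤ) := by
      rw [map_mul]
      exact mul_le_mul' hfP (val_le_of_forall_prime_eq hβ hα (hwv _ hw2))
    rw [hab, val_algebraMap_eq_one hpi hβ hα hpa, ← WithZero.exp_add, ← WithZero.exp_zero,
      WithZero.exp_le_exp] at h3
    norm_num at h3
  · have h3 := hfQ w hw
    have h4 := (val_algebraMap_lt_one_iff hpi hw1 hw2 p).2 dvd_rfl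
    have h5 := val_algebraMap_eq_one hpi hw1 hw2 hpa
    rw [← hab, map_mul] at h5
    exact absurd h5 ((mul_le_of_le_one_left' h3).trans_lt h4).ne

theorem ell_single_add_le {P : Place K (CurveField K)} (hP : P.degree = 1) :
    ell (Finsupp.single P 1 + Finsupp.single (infinityPlace K) 2) ≤ 2 := by
  let ψ : degreeLT K 2 →ₗ[K] CurveField K :=
    ((Algebra.ofId K[X] (CurveField K)).restrictScalars K).toLinearMap ∘ₗ Submodule.subtype _
  have hle : riemannRochSpace (Finsupp.single P 1 + Finsupp.single (infinityPlace K) 2) ≤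
      LinearMap.range ψ := fun f hf => by
    obtain ⟨q, hq, rfl⟩ := exists_eq_of_mem_single_add hP hf
    exact ⟨⟨q, mem_degreeLT_iff.2 (Or.inr (by omega))⟩, rfl⟩
  refine (Submodule.finrank_mono hle).trans ((LinearMap.finrank_range_le ψ).trans ?_)
  rw [(degreeLTEquiv K 2).finrank_eq, Module.finrank_fin_fun]

variable [Finite K]

/-- Subtracting a multiple of ∞ reduces to degree 3. There ℓ(A) ≥ 3 would leave a nonzero function
in L(A - 2∞), of degree 1; so A would be equivalent to P + 2∞ with P rational, whose ℓ is at most 2.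
-/
theorem ell_le_degree_sub_one {A : Divisor K (CurveField K)} (hA : 3 ≤ A.degree) :
    (ell A : ℤ) ≤ A.degree - 1 := by
  classical
  have hg := hasGenus_curveField K
  have h3 : ∀ A : Divisor K (CurveField K), A.degree = 3 → ell A ≤ 2 := by
    intro A hA
    by_contra! hlt
    have hle : A - Finsupp.single (infinityPlace K) 2 ≤ A :=
      sub_le_self _ (Finsupp.single_nonneg.2 (by norm_num))
    have h1 := ell_le_of_le hle
    have hd : (A - Finsupp.single (infinityPlace K) 2).degree = 1 := by
      rw [Divisor.degree_sub, Divisor.degree_single, degree_infinityPlace, hA]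
      norm_num
    rw [hd, hA] at h1
    have hpos : 0 < ell (A - Finsupp.single (infinityPlace K) 2) := by omega
    have := Module.finrank_pos_iff.1 hpos
    obtain ⟨⟨f, hf⟩, hf0⟩ := exists_ne (0 : riemannRochSpace (A - Finsupp.single (infinityPlace K) 2))
    have hf0' : f ≠ 0 := fun h => hf0 (Subtype.ext h)
    obtain ⟨P, hP, hval⟩ := exists_val_eq_of_degree_eq_one hg hf hf0' hd
    have hell : ell A ≤ ell (Finsupp.single P 1 + Finsupp.single (infinityPlace K) 2) := by
      refine ell_le_of_mul_mem (inv_ne_zero hf0') fun g hgA => ?_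
      rw [mem_riemannRochSpace] at hgA ⊢
      intro Q
      rw [map_mul, map_inv₀, hval, ← WithZero.exp_neg]
      refine (mul_le_mul' le_rfl (hgA Q)).trans ?_
      rw [← WithZero.exp_add, WithZero.exp_le_exp]
      simp only [Finsupp.sub_apply, Finsupp.add_apply]
      linarith
    exact absurd (hell.trans (ell_single_add_le hP)) (by omega)
  obtain ⟨d, hd⟩ := Int.eq_ofNat_of_zero_le (sub_nonneg.2 hA)
  have hle : A - Finsupp.single (infinityPlace K) (d : ℤ) ≤ A :=
    sub_le_self _ (Finsupp.single_nonneg.2 (by simp))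
  have hdeg : (A - Finsupp.single (infinityPlace K) (d : ℤ)).degree = 3 := by
    rw [Divisor.degree_sub, Divisor.degree_single, degree_infinityPlace]
    push_cast
    linarith
  have h1 := ell_le_of_le hle
  have h2 := h3 _ hdeg
  rw [hdeg] at h1
  omega

theorem ell_eq_degree_sub_one {A : Divisor K (CurveField K)} (hA : 3 ≤ A.degree) :
    (ell A : ℤ) = A.degree - 1 :=
  le_antisymm (ell_le_degree_sub_one hA) (degree_sub_one_le_ell A)

end Nonspecial

/-! ### Evaluation codes at rational places. -/

section EvaluationCodes

variable {K F : Type*} [Field K] [Field F] [Algebra K F] {n : ℕ}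
  {P : Fin n → Place K F} {A : Divisor K F}

theorem agCode_mono {B : Divisor K F} [HasDiscretePlaces K F] (h : A ≤ B) :
    agCode P A ≤ agCode P B := by
  rintro c ⟨f, hf, hc⟩
  exact ⟨f, riemannRochSpace_mono h hf, hc⟩

variable [HasDiscretePlaces K F] (hdeg : ∀ i, (P i).degree = 1) (hA : ∀ i, A (P i) = 0)

include hdeg hA in
theorem exists_eval (f : riemannRochSpace A) (i : Fin n) :
    ∃ c : K, (P i).ring.valuation (f - algebraMap K F c) < 1 := by
  refine Place.exists_valuation_sub_lt_one (hdeg i) ((P i).val_le_one_iff.1 ?_)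
  simpa [hA i] using mem_riemannRochSpace.1 f.2 (P i)

/-- Evaluation at rational places. -/
def evalMap : riemannRochSpace A →ₗ[K] (Fin n → K) where
  toFun f i := (exists_eval hdeg hA f i).choose
  map_add' f g := funext fun i => by
    refine Place.eq_of_valuation_sub_lt_one (exists_eval hdeg hA (f + g) i).choose_spec ?_
    have h : ((f + g : riemannRochSpace A) : F) - algebraMap K F
        ((exists_eval hdeg hA f i).choose + (exists_eval hdeg hA g i).choose) =
        (f - algebraMap K F (exists_eval hdeg hA f i).choose) +
        (g - algebraMap K F (exists_eval hdeg hA g i).choose) := by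
      rw [map_add, Submodule.coe_add]
      ring
    exact h ▸ Valuation.map_add_lt _ (exists_eval hdeg hA f i).choose_spec
      (exists_eval hdeg hA g i).choose_spec
  map_smul' a f := funext fun i => by
    refine Place.eq_of_valuation_sub_lt_one (exists_eval hdeg hA (a • f) i).choose_spec ?_
    have h : ((a • f : riemannRochSpace A) : F) - algebraMap K F
        (a * (exists_eval hdeg hA f i).choose) =
        algebraMap K F a * (f - algebraMap K F (exists_eval hdeg hA f i).choose) := by
      rw [map_mul, Submodule.coe_smul, Algebra.smul_def]
      ring
    refine h ▸ ?_
    rw [map_mul]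
    exact (mul_le_of_le_one_left' ((P i).valuation_algebraMap_le a)).trans_lt
      (exists_eval hdeg hA f i).choose_spec

theorem evalMap_spec (f : riemannRochSpace A) (i : Fin n) :
    (P i).ring.valuation (f - algebraMap K F (evalMap hdeg hA f i)) < 1 :=
  (exists_eval hdeg hA f i).choose_spec

theorem range_evalMap : LinearMap.range (evalMap hdeg hA) = agCode P A := by
  ext c
  constructor
  · rintro ⟨f, rfl⟩
    exact ⟨f, f.2, evalMap_spec hdeg hA f⟩
  · rintro ⟨f, hf, hc⟩
    refine ⟨⟨f, hf⟩, funext fun i => ?_⟩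
    have h := evalMap_spec hdeg hA ⟨f, hf⟩ i
    exact Place.eq_of_valuation_sub_lt_one (f := f) h (hc i)

theorem evalMap_eq_zero_iff (f : riemannRochSpace A) (i : Fin n) :
    evalMap hdeg hA f i = 0 ↔ (P i).val f < 1 := by
  rw [Place.val_lt_one_iff]
  constructor
  · intro h
    have := evalMap_spec hdeg hA f i
    rwa [h, map_zero, sub_zero] at this
  · intro h
    exact Place.eq_of_valuation_sub_lt_one (evalMap_spec hdeg hA f i) (by simpa using h)

/-- The sum of the places `P i` with `i ∈ S`. -/
def pointDivisor (P : Fin n → Place K F) (S : Finset (Fin n)) : Divisor K F :=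
  ∑ i ∈ S, Finsupp.single (P i) 1

omit [HasDiscretePlaces K F] in
include hdeg in
theorem degree_pointDivisor (S : Finset (Fin n)) : (pointDivisor P S).degree = S.card := by
  classical
  unfold pointDivisor
  induction S using Finset.induction_on with
  | empty => simp [Divisor.degree_zero]
  | insert i S hi ih =>
    rw [Finset.sum_insert hi, Divisor.degree_add, ih, Divisor.degree_single, hdeg,
      Finset.card_insert_of_notMem hi]
    push_cast
    ring

omit [HasDiscretePlaces K F] in
theorem pointDivisor_nonneg (S : Finset (Fin n)) : 0 ≤ pointDivisor P S :=
  Finset.sum_nonneg fun _ _ => Finsupp.single_nonneg.2 zero_le_one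

omit [HasDiscretePlaces K F] in
theorem pointDivisor_apply (hP : Function.Injective P) {S : Finset (Fin n)} {i : Fin n}
    (hi : i ∈ S) : pointDivisor P S (P i) = 1 := by
  classical
  rw [pointDivisor, Finsupp.finsetSum_apply, Finset.sum_eq_single i]
  · simp
  · intro j _ hj
    rw [Finsupp.single_eq_of_ne fun h => hj (hP h.symm)]
  · exact fun h => absurd hi h

omit [HasDiscretePlaces K F] in
theorem pointDivisor_apply_of_ne {S : Finset (Fin n)} {Q : Place K F} (hQ : ∀ i ∈ S, P i ≠ Q) :
    pointDivisor P S Q = 0 := by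
  rw [pointDivisor, Finsupp.finsetSum_apply]
  exact Finset.sum_eq_zero fun i hi => Finsupp.single_eq_of_ne (hQ i hi).symm

theorem forall_evalMap_eq_zero_iff (hP : Function.Injective P) (S : Finset (Fin n))
    (f : riemannRochSpace A) : (∀ i ∈ S, evalMap hdeg hA f i = 0) ↔
      (f : F) ∈ riemannRochSpace (A - pointDivisor P S) := by
  simp only [evalMap_eq_zero_iff, mem_riemannRochSpace]
  constructor
  · intro h Q
    by_cases hQ : ∃ i ∈ S, P i = Q
    · obtain ⟨i, hi, rfl⟩ := hQ
      have h1 := h i hi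
      rw [← WithZero.exp_zero, Place.lt_exp_iff] at h1
      rwa [Finsupp.sub_apply, hA, pointDivisor_apply hP hi]
    · push Not at hQ
      rw [Finsupp.sub_apply, pointDivisor_apply_of_ne hQ, sub_zero]
      exact mem_riemannRochSpace.1 f.2 Q
  · intro h i hi
    have h1 := h (P i)
    rwa [Finsupp.sub_apply, hA, pointDivisor_apply hP hi, ← Place.lt_exp_iff,
      WithZero.exp_zero] at h1

variable [Module.Finite K (riemannRochSpace (0 : Divisor K F))]

include hdeg hA in
/-- A function in `L(A)` with more than `deg A` zeros vanishes. -/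
theorem eq_zero_of_forall_not_mem (hP : Function.Injective P) {g : ℕ} (hg : HasGenus K F g)
    {S : Finset (Fin n)} (hS : A.degree + S.card < n) {c : Fin n → K} (hc : c ∈ agCode P A)
    (h : ∀ i ∉ S, c i = 0) : c = 0 := by
  rw [← range_evalMap hdeg hA] at hc
  obtain ⟨f, rfl⟩ := hc
  have h1 := (forall_evalMap_eq_zero_iff hdeg hA hP Sᶜ f).1 fun i hi =>
    h i (Finset.mem_compl.1 hi)
  have hcard := Finset.card_add_card_compl S
  rw [Fintype.card_fin] at hcard
  rw [riemannRochSpace_eq_bot hg (by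
    rw [Divisor.degree_sub, degree_pointDivisor hdeg]
    omega), Submodule.mem_bot] at h1
  rw [show f = 0 from Subtype.ext h1, map_zero]

include hdeg hA in
-- The kernel of evaluation is L(A - D), zero because its degree is negative.
theorem finrank_agCode (hP : Function.Injective P) {g : ℕ} (hg : HasGenus K F g)
    (hn : A.degree < n) : Module.finrank K (agCode P A) = ell A := by
  rw [← range_evalMap hdeg hA]
  refine LinearMap.finrank_range_of_inj ?_
  rw [← LinearMap.ker_eq_bot, LinearMap.ker_eq_bot']
  intro f hf
  have h1 := (forall_evalMap_eq_zero_iff hdeg hA hP Finset.univ f).1 fun i _ => by rw [hf]; rfl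
  rw [riemannRochSpace_eq_bot hg (by
    rw [Divisor.degree_sub, degree_pointDivisor hdeg, Finset.card_univ, Fintype.card_fin]
    omega), Submodule.mem_bot] at h1
  exact Subtype.ext h1

include hdeg hA in
/-- The code is systematic on `S` if the points of `S` impose independent conditions on `L(A)`. -/
theorem exists_mem_agCode_eq (hP : Function.Injective P) {S : Finset (Fin n)}
    (hS : ell (A - pointDivisor P S) + S.card ≤ ell A) (w : Fin n → K) :
    ∃ c ∈ agCode P A, ∀ i ∈ S, c i = w i := by
  let ρ : riemannRochSpace A →ₗ[K] (S → K) :=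
    LinearMap.funLeft K K (Subtype.val : S → Fin n) ∘ₗ evalMap hdeg hA
  have hρ : ∀ f (i : S), ρ f i = evalMap hdeg hA f i := fun f i => rfl
  have hle : riemannRochSpace (A - pointDivisor P S) ≤ riemannRochSpace A :=
    riemannRochSpace_mono (sub_le_self _ (pointDivisor_nonneg S))
  have hker : LinearMap.ker ρ =
      Submodule.comap (Submodule.subtype _) (riemannRochSpace (A - pointDivisor P S)) := by
    ext f
    rw [LinearMap.mem_ker, Submodule.mem_comap, Submodule.subtype_apply,
      ← forall_evalMap_eq_zero_iff hdeg hA hP]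
    exact ⟨fun h i hi => by rw [← hρ f ⟨i, hi⟩, h]; rfl, fun h => funext fun i => h i i.2⟩
  have h1 := LinearMap.finrank_range_add_finrank_ker ρ
  rw [hker, (Submodule.comapSubtypeEquivOfLe hle).finrank_eq] at h1
  -- The rank ℓ(A) - ℓ(A - Σ_S P_i) is at least |S|, the dimension of the target.
  have htop : LinearMap.range ρ = ⊤ := by
    refine Submodule.eq_top_of_finrank_eq (le_antisymm (Submodule.finrank_le _) ?_)
    rw [Module.finrank_fintype_fun_eq_card, Fintype.card_coe]
    unfold ell at hS
    omega
  obtain ⟨f, hf⟩ := LinearMap.range_eq_top.1 htop fun i => w i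
  refine ⟨evalMap hdeg hA f, ?_, fun i hi => ?_⟩
  · rw [← range_evalMap hdeg hA]
    exact ⟨f, rfl⟩
  · rw [← hρ f ⟨i, hi⟩, hf]

end EvaluationCodes

/-! ### The 46 rational places and a place of degree two. -/

section Points

variable {K : Type*} [Field K] [CharP K 5]

theorem exists_rational_place {a b : K} (h : b ^ 5 + b = a ^ 2) :
    ∃ P : Place K (CurveField K), P.degree = 1 ∧ P ≠ infinityPlace K ∧
      P.ring.valuation (curveX K - algebraMap K _ a) < 1 ∧
      P.ring.valuation (curveY K - algebraMap K _ b) < 1 := by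
  obtain ⟨v, h1, h2⟩ := exists_prime_of_dvd (K := K) (p := X - C b) (s := C a)
    (not_isUnit_X_sub_C b) (by simp [dvd_iff_isRoot, h])
  refine ⟨placeOfPrime K _ v, ?_, placeOfPrime_ne_infinityPlace v, ?_, ?_⟩
  · rw [← Place.comap_refl (placeOfPrime K _ v),
      degree_comap_placeOfPrime (irreducible_X_sub_C b) h1 h2, natDegree_X_sub_C]
  · have h3 := (placeOfPrime_valuation_lt_one_iff (K := K) (F := CurveField K) v _).2
      ((v.valuation_lt_one_iff_mem _).2 h2)
    change (placeOfPrime K _ v).ring.valuation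
      (curveX K - algebraMap K[X] (CurveField K) (C a)) < 1 at h3
    rwa [algebraMap_C_curveField] at h3
  · have h3 := (placeOfPrime_valuation_lt_one_iff (K := K) (F := CurveField K) v _).2
      ((v.valuation_lt_one_iff_mem _).2 h1)
    change (placeOfPrime K _ v).ring.valuation
      (algebraMap K[X] (CurveField K) (X - C b)) < 1 at h3
    rwa [map_sub, algebraMap_X_curveField, algebraMap_C_curveField] at h3

/-- The affine curve over a field with `25` elements has at least `45` points. -/
theorem exists_points [Fintype K] (hK : Fintype.card K = 25) :
    ∃ e : Fin 45 → K × K, Function.Injective e ∧ ∀ i, (e i).2 ^ 5 + (e i).2 = (e i).1 ^ 2 := by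
  classical
  have hsq : ∀ b : K, ∃ a : K, b ^ 5 + b = a ^ 2 := by
    intro b
    rcases eq_or_ne (b ^ 5 + b) 0 with h0 | h0
    · exact ⟨0, by simp [h0]⟩
    -- As b^25 = b, the trace c = b^5 + b satisfies c^5 = c. If c ≠ 0, then c^4 = 1 and c^12 = 1,
    -- which is Euler's criterion in a field with 25 elements.
    have h5 : (b ^ 5 + b) ^ 5 = b ^ 5 + b := by
      have : Fact (Nat.Prime 5) := ⟨by norm_num⟩
      rw [add_pow_char, ← pow_mul, add_comm]
      have := FiniteField.pow_card b
      rw [hK] at this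
      rw [this]
    have h4 : (b ^ 5 + b) ^ 4 = 1 := mul_right_cancel₀ h0 (by rw [← pow_succ, h5, one_mul])
    have hchar : ringChar K ≠ 2 := by
      rw [ringChar.eq K 5]
      norm_num
    obtain ⟨a, ha⟩ := (FiniteField.isSquare_iff hchar h0).2 (by
      rw [hK, show 25 / 2 = 4 * 3 by norm_num, pow_mul, h4, one_pow])
    exact ⟨a, by rw [ha, sq]⟩
  choose a ha using hsq
  set Z : Finset K := Finset.univ.filter fun b : K => b ^ 5 + b = 0 with hZ
  have hZcard : Z.card ≤ 5 := by
    have hdeg : (X ^ 5 + X : K[X]).natDegree = 5 := by compute_degree!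
    have hne : (X ^ 5 + X : K[X]) ≠ 0 := fun h => by simp [h] at hdeg
    refine le_trans ?_ (hdeg ▸ card_roots' (X ^ 5 + X : K[X]))
    refine le_trans (Finset.card_le_card (t := (X ^ 5 + X : K[X]).roots.toFinset) fun b hb => ?_)
      (Multiset.toFinset_card_le _)
    rw [Multiset.mem_toFinset, mem_roots hne]
    simpa using (Finset.mem_filter.1 hb).2
  -- One point over each of the 25 values b, and a second one, with the opposite root, over each of
  -- the at least 20 values with b^5 + b ≠ 0.
  let U₁ : Finset (K × K) := Finset.univ.image fun b => (a b, b)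
  let U₂ : Finset (K × K) := Zᶜ.image fun b => (-a b, b)
  have hU₁ : U₁.card = 25 := by
    rw [Finset.card_image_of_injective _ fun b b' h => (Prod.ext_iff.1 h).2, Finset.card_univ, hK]
  have hU₂ : 20 ≤ U₂.card := by
    rw [Finset.card_image_of_injective _ fun b b' h => (Prod.ext_iff.1 h).2, Finset.card_compl, hK]
    omega
  have hdisj : Disjoint U₁ U₂ := by
    rw [Finset.disjoint_left]
    rintro x hx₁ hx₂
    obtain ⟨b, -, rfl⟩ := Finset.mem_image.1 hx₁
    obtain ⟨b', hb', h⟩ := Finset.mem_image.1 hx₂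
    obtain ⟨h1, rfl⟩ := Prod.ext_iff.1 h
    simp only at h1
    have h2 : (2 : K) * a b' = 0 := by linear_combination -h1
    have h3 := (mul_eq_zero.1 h2).resolve_left two_ne_zero_of_charP_five
    refine Finset.mem_compl.1 hb' (Finset.mem_filter.2 ⟨Finset.mem_univ _, ?_⟩)
    rw [ha, h3, sq, zero_mul]
  have hcard : 45 ≤ (U₁ ∪ U₂).card := by
    rw [Finset.card_union_of_disjoint hdisj]
    omega
  obtain ⟨V, hV, hV45⟩ := Finset.exists_subset_card_eq hcard
  let e := V.equivFinOfCardEq hV45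
  refine ⟨fun i => e.symm i, Subtype.val_injective.comp e.symm.injective, fun i => ?_⟩
  rcases Finset.mem_union.1 (hV (e.symm i).2) with h | h
  · obtain ⟨b, -, hb⟩ := Finset.mem_image.1 h
    simp only [← hb]
    exact ha b
  · obtain ⟨b, -, hb⟩ := Finset.mem_image.1 h
    simp only [← hb, neg_sq]
    exact ha b

theorem exists_rational_places [Fintype K] (hK : Fintype.card K = 25) :
    ∃ P : Fin 46 → Place K (CurveField K), Function.Injective P ∧ ∀ i, (P i).degree = 1 := by
  obtain ⟨e, he, hc⟩ := exists_points hK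
  choose P hdeg hinf hx hy using fun i => exists_rational_place (hc i)
  refine ⟨Fin.cons (infinityPlace K) P, Fin.cons_injective_iff.2 ⟨?_, fun i j hij => ?_⟩, ?_⟩
  · rintro ⟨i, hi⟩
    exact hinf i hi
  · refine he (Prod.ext ?_ ?_)
    · exact Place.eq_of_valuation_sub_lt_one (hx i) (hij ▸ hx j)
    · exact Place.eq_of_valuation_sub_lt_one (hy i) (hij ▸ hy j)
  · refine Fin.cases ?_ fun i => ?_
    · exact degree_infinityPlace
    · exact hdeg i

theorem exists_degree_two_place [Fintype K] (hK : Fintype.card K = 25) :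
    ∃ G : Place K (CurveField K), G.degree = 2 := by
  have h5 : (5 : K) = 0 := by exact_mod_cast CharP.cast_eq_zero K 5
  have hchar : ringChar K ≠ 2 := by
    rw [ringChar.eq K 5]
    norm_num
  obtain ⟨g, hg⟩ : IsSquare (2 : K) := by
    rw [FiniteField.isSquare_iff hchar two_ne_zero_of_charP_five, hK]
    norm_num
    linear_combination 819 * h5
  -- If g = h², then h^4 = 2 and h^24 = 64 = -1, contradicting h^25 = h.
  have hg' : ¬ IsSquare g := by
    rintro ⟨h, rfl⟩
    have h1 : h ^ 25 = h := by rw [← hK]; exact FiniteField.pow_card h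
    have h2 : h ^ 4 = 2 := by rw [hg]; ring
    have h3 : h ^ 25 = 64 * h := by
      rw [show h ^ 25 = (h ^ 4) ^ 6 * h by ring, h2]
      norm_num
    have h0 : h ≠ 0 := by
      rintro rfl
      exact two_ne_zero_of_charP_five (K := K) (by rw [hg]; ring)
    have h4 : (64 : K) * h = 1 * h := by rw [← h3, h1, one_mul]
    have h6 := mul_right_cancel₀ h0 h4
    exact two_ne_zero_of_charP_five (K := K) (by linear_combination -h6 + 13 * h5)
  set p : K[X] := (X - C 3) ^ 2 - C g with hp
  have hdeg : p.natDegree = 2 := by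
    rw [hp]
    compute_degree!
  have hirr : Irreducible p := by
    refine (irreducible_iff_roots_eq_zero_of_degree_le_three hdeg.ge (by omega)).2 ?_
    refine Multiset.eq_zero_of_forall_notMem fun b hb => hg' ⟨b - 3, ?_⟩
    have := (mem_roots'.1 hb).2
    simp [hp] at this
    linear_combination -this
  -- With u = y - 3 and u² = g, g² = 2, one has y^5 + y = 3u + 1, and (2 + 2g) + (3 + 2g)u is a
  -- square root of it modulo p.
  have hdvd : p ∣ curveRHS K - (C (2 + 2 * g) + C (3 + 2 * g) * (X - C 3)) ^ 2 := by
    refine ⟨(X - C 3) * ((X - C 3) ^ 2 + C g) - C (3 + 2 * g) ^ 2, ?_⟩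
    have hG : C g * C g = (2 : K[X]) := by rw [← C_mul, ← hg, C_ofNat]
    have h5' : (5 : K[X]) = 0 := by rw [← C_ofNat, h5, C_0]
    simp only [hp, C_add, C_mul, C_ofNat]
    grind
  obtain ⟨v, h1, h2⟩ := exists_prime_of_dvd hirr.not_isUnit hdvd
  refine ⟨placeOfPrime K _ v, ?_⟩
  rw [← Place.comap_refl (placeOfPrime K _ v), degree_comap_placeOfPrime hirr h1 h2, hdeg]

end Points

/-! ### Detection, dimension and distance of CSS codes. -/

section CSSCodes

variable {K : Type*} [Field K] [Fintype K] {n : ℕ}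

open Classical in
theorem inner_cosetState (C : Submodule K (Fin n → K)) (v : Fin n → K) (ψ : StateSpace K n) :
    inner ℂ (cosetState C v) ψ = ∑ u with u - v ∈ C, ψ u := by
  rw [PiLp.inner_apply, Finset.sum_filter]
  refine Finset.sum_congr rfl fun u _ => ?_
  by_cases h : u - v ∈ C <;> simp [cosetState, h]

open Classical in
theorem inner_cosetState_toEuclideanLin (C : Submodule K (Fin n → K)) (v w : Fin n → K)
    (E : Matrix (Fin n → K) (Fin n → K) ℂ) :
    inner ℂ (cosetState C v) (Matrix.toEuclideanLin E (cosetState C w)) =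
      ∑ u with u - v ∈ C, ∑ u' with u' - w ∈ C, E u u' := by
  rw [inner_cosetState]
  refine Finset.sum_congr rfl fun u _ => ?_
  rw [Finset.sum_filter, Matrix.toLpLin_apply]
  change ∑ u', E u u' * cosetState C w u' = _
  refine Finset.sum_congr rfl fun u' _ => ?_
  by_cases h : u' - w ∈ C <;> simp [cosetState, h]

open Classical in
theorem cosetState_eq {C : Submodule K (Fin n → K)} {v w : Fin n → K} (h : v - w ∈ C) :
    cosetState C v = cosetState C w := by
  have : ∀ u : Fin n → K, u - v ∈ C ↔ u - w ∈ C := fun u => by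
    rw [← sub_add_sub_cancel u v w, Submodule.add_mem_iff_left _ h]
  exact congrArg (WithLp.toLp 2) (funext fun u => if_congr (this u) rfl rfl)

open Classical in
-- Some c in C agrees with v on S, so translation by c - v carries v + C onto C without changing g.
-- Distinct cosets are disjoint.
theorem sum_coset_eq_ite {C : Submodule K (Fin n → K)} {S : Finset (Fin n)}
    (hC : ∀ w : Fin n → K, ∃ c ∈ C, ∀ i ∈ S, c i = w i) {g : (Fin n → K) → ℂ}
    (hg : ∀ u u', (∀ i ∈ S, u i = u' i) → g u = g u') (v w : Fin n → K) :
    ∑ u with u - v ∈ C ∧ u - w ∈ C, g u = if v - w ∈ C then ∑ u with u ∈ C, g u else 0 := by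
  split_ifs with hvw
  · obtain ⟨c, hc, hcv⟩ := hC v
    refine Finset.sum_equiv (Equiv.addRight (c - v)) (fun u => ?_) (fun u _ => hg _ _ fun i hi => ?_)
    · have h1 : u - w = (u - v) + (v - w) := by abel
      have h2 : u + (c - v) = (u - v) + c := by abel
      simp only [Finset.mem_filter, Finset.mem_univ, true_and, Equiv.coe_addRight]
      rw [h1, h2, Submodule.add_mem_iff_left _ hvw, Submodule.add_mem_iff_left _ hc, and_self]
    · simp [hcv i hi]
  · rw [Finset.filter_false_of_mem, Finset.sum_empty]
    rintro u - ⟨h1, h2⟩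
    refine hvw ?_
    have := C.sub_mem h2 h1
    rwa [sub_sub_sub_cancel_left] at this

open Classical in
theorem inner_cosetState_cosetState (C : Submodule K (Fin n → K)) (v w : Fin n → K) :
    inner ℂ (cosetState C v) (cosetState C w) =
      if v - w ∈ C then (∑ u with u ∈ C, (1 : ℂ) : ℂ) else 0 := by
  rw [inner_cosetState, ← sum_coset_eq_ite (S := ∅) (fun w => ⟨0, C.zero_mem, by simp⟩)
    (fun _ _ _ => rfl) v w, ← Finset.filter_filter, Finset.sum_filter (s := Finset.univ.filter _)]
  exact Finset.sum_congr rfl fun u _ => rfl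

theorem sum_one_ne_zero (C : Submodule K (Fin n → K)) [DecidablePred (· ∈ C)] :
    (∑ u with u ∈ C, (1 : ℂ) : ℂ) ≠ 0 := by
  rw [Finset.sum_const, nsmul_one, Nat.cast_ne_zero, Finset.card_ne_zero]
  exact ⟨0, by simp⟩

variable {C₁ C₂ : Submodule K (Fin n → K)}

open Classical in
/-- An error is detected as soon as the condition holds on the coset states. -/
theorem detects_cssCode {E : Matrix (Fin n → K) (Fin n → K) ℂ} {c : ℂ}
    (h : ∀ v ∈ C₂, ∀ w ∈ C₂, inner ℂ (cosetState C₁ v)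
      (Matrix.toEuclideanLin E (cosetState C₁ w)) =
        c * inner ℂ (cosetState C₁ v) (cosetState C₁ w)) :
    Detects (cssCode C₁ C₂) E := by
  refine ⟨c, fun φ hφ ψ hψ => ?_⟩
  induction hφ using Submodule.span_induction with
  | mem φ hφ =>
    obtain ⟨v, hv, rfl⟩ := hφ
    induction hψ using Submodule.span_induction with
    | mem ψ hψ =>
      obtain ⟨w, hw, rfl⟩ := hψ
      exact h v hv w hw
    | zero => simp
    | add x y _ _ hx hy => rw [map_add, inner_add_right, inner_add_right, hx, hy, mul_add]
    | smul a x _ hx => rw [map_smul, inner_smul_right, inner_smul_right, hx]; ring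
  | zero => simp
  | add x y _ _ hx hy => rw [inner_add_left, inner_add_left, hx, hy, mul_add]
  | smul a x _ hx => rw [inner_smul_left, inner_smul_left, hx]; ring

open Classical in
-- The operator links only words that agree outside S, and two such words of C₂ are equal by the
-- first condition. What remains is a diagonal sum over a coset of C₁, depending only on the
-- coordinates in S; by the second condition it is the same for every coset.
theorem detects_localOperator (hle : C₁ ≤ C₂) {S : Finset (Fin n)}
    (h₂ : ∀ c ∈ C₂, (∀ i ∉ S, c i = 0) → c = 0)
    (h₁ : ∀ w : Fin n → K, ∃ c ∈ C₁, ∀ i ∈ S, c i = w i) (N : Matrix (S → K) (S → K) ℂ) :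
    Detects (cssCode C₁ C₂) (localOperator S N) := by
  set g : (Fin n → K) → ℂ := fun u => N (fun i => u i) (fun i => u i) with hg
  have hgS : ∀ u u' : Fin n → K, (∀ i ∈ S, u i = u' i) → g u = g u' := fun u u' h => by
    have : (fun i : S => u i) = fun i : S => u' i := funext fun i => h i i.2
    simp only [hg, this]
  refine detects_cssCode (c := (∑ u with u ∈ C₁, g u) / ∑ u with u ∈ C₁, (1 : ℂ))
    fun v hv w hw => ?_
  have hdiag : ∀ u u', u - v ∈ C₁ → u' - w ∈ C₁ →
      localOperator S N u u' = if u = u' then g u else 0 := by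
    intro u u' hu hu'
    unfold localOperator
    by_cases huu : u = u'
    · subst huu
      simp [hg]
    · rw [if_neg huu, if_neg]
      intro h
      refine huu (sub_eq_zero.1 (h₂ _ ?_ fun i hi => ?_))
      · have h1 : u - u' = (u - v) + v - ((u' - w) + w) := by abel
        rw [h1]
        exact C₂.sub_mem (C₂.add_mem (hle hu) hv) (C₂.add_mem (hle hu') hw)
      · rw [Pi.sub_apply, h i hi, sub_self]
  have hsum : ∑ u with u - v ∈ C₁, ∑ u' with u' - w ∈ C₁, localOperator S N u u' =
      ∑ u with u - v ∈ C₁ ∧ u - w ∈ C₁, g u := by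
    rw [← Finset.filter_filter, Finset.sum_filter (s := Finset.univ.filter _)]
    refine Finset.sum_congr rfl fun u hu => ?_
    have hu' := (Finset.mem_filter.1 hu).2
    rw [Finset.sum_congr rfl fun u' hu' => hdiag u u' (Finset.mem_filter.1 hu).2
      (Finset.mem_filter.1 hu').2, Finset.sum_ite_eq]
    simp
  rw [inner_cosetState_toEuclideanLin, hsum, sum_coset_eq_ite h₁ hgS,
    inner_cosetState_cosetState]
  have := sum_one_ne_zero C₁
  split_ifs
  · rw [div_mul_cancel₀ _ this]
  · rw [mul_zero]

open Classical in
-- States of distinct cosets have disjoint supports, hence are orthogonal and independent, and there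
-- are |C₂/C₁| of them.
theorem finrank_cssCode (hle : C₁ ≤ C₂) {k : ℕ}
    (hk : Module.finrank K C₂ = Module.finrank K C₁ + k) :
    Module.finrank ℂ (cssCode C₁ C₂) = Fintype.card K ^ k := by
  let Q := C₂ ⧸ C₁.submoduleOf C₂
  let s : Q → StateSpace K n := fun q => cosetState C₁ (q.out : C₂)
  have hmk : ∀ v : C₂, (v : Fin n → K) - (Submodule.Quotient.mk (p := C₁.submoduleOf C₂) v).out
      ∈ C₁ := fun v => by
    have h : Submodule.Quotient.mk (p := C₁.submoduleOf C₂) v =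
        Submodule.Quotient.mk (Submodule.Quotient.mk (p := C₁.submoduleOf C₂) v).out :=
      (Quotient.out_eq _).symm
    exact (Submodule.Quotient.eq (C₁.submoduleOf C₂)).1 h
  have hrange : cosetState C₁ '' (C₂ : Set (Fin n → K)) = Set.range s := by
    ext φ
    constructor
    · rintro ⟨v, hv, rfl⟩
      exact ⟨Submodule.Quotient.mk ⟨v, hv⟩, (cosetState_eq (hmk ⟨v, hv⟩)).symm⟩
    · rintro ⟨q, rfl⟩
      exact ⟨_, q.out.2, rfl⟩
  have hne : ∀ q, s q ≠ 0 := fun q h => by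
    have h1 := inner_cosetState_cosetState C₁ (q.out : C₂) (q.out : C₂)
    rw [sub_self, if_pos C₁.zero_mem] at h1
    refine sum_one_ne_zero C₁ (h1.symm.trans ?_)
    change inner ℂ (s q) (s q) = _
    rw [h, inner_zero_left]
  have horth : Pairwise fun q q' => inner ℂ (s q) (s q') = 0 := fun q q' hqq => by
    change inner ℂ (cosetState C₁ (q.out : C₂)) (cosetState C₁ (q'.out : C₂)) = 0
    rw [inner_cosetState_cosetState, if_neg]
    intro h
    refine hqq ?_
    rw [← Quotient.out_eq q, ← Quotient.out_eq q']
    exact (Submodule.Quotient.eq (C₁.submoduleOf C₂)).2 h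
  have hli := linearIndependent_of_ne_zero_of_inner_eq_zero hne horth
  have : Fintype Q := Fintype.ofFinite _
  have hQ : Module.finrank K Q = k := by
    have h1 := Submodule.finrank_quotient_add_finrank (C₁.submoduleOf C₂)
    rw [(Submodule.submoduleOfEquivOfLe hle).finrank_eq] at h1
    change Module.finrank K Q + _ = _ at h1
    omega
  rw [cssCode, hrange, finrank_span_eq_card hli, Module.card_eq_pow_finrank (K := K), hQ]

open Classical in
-- Ensures that a minimum distance exists. The operator |0⟩⟨0| has matrix element 1 on the state of
-- C₁ and 0 on that of another coset, while the two states have equal norm.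
theorem not_detects_univ (hle : C₁ ≤ C₂) (hne : C₁ ≠ C₂) :
    ∃ N, ¬ Detects (cssCode C₁ C₂) (localOperator Finset.univ N) := by
  obtain ⟨v, hv2, hv1⟩ := SetLike.exists_of_lt (lt_of_le_of_ne hle hne)
  obtain ⟨N, hN⟩ : ∃ N, ∀ u u' : Fin n → K,
      localOperator Finset.univ N u u' = if u = 0 ∧ u' = 0 then 1 else 0 := by
    refine ⟨fun a b => if a = 0 ∧ b = 0 then 1 else 0, fun u u' => ?_⟩
    have h1 : ∀ u : Fin n → K, (fun i : (Finset.univ : Finset (Fin n)) => u i) = 0 ↔ u = 0 :=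
      fun u => ⟨fun h => funext fun i => congrFun h ⟨i, Finset.mem_univ i⟩, fun h => by
        subst h; rfl⟩
    simp [localOperator, h1]
  refine ⟨N, fun ⟨c, hc⟩ => ?_⟩
  have hinner : ∀ w, inner ℂ (cosetState C₁ w)
      (Matrix.toEuclideanLin (localOperator Finset.univ N) (cosetState C₁ w)) =
        if w ∈ C₁ then 1 else 0 := by
    intro w
    rw [inner_cosetState_toEuclideanLin]
    simp only [hN, ite_and]
    by_cases hw : w ∈ C₁ <;> simp [hw]
  have hspan : ∀ w ∈ C₂, cosetState C₁ w ∈ cssCode C₁ C₂ := fun w hw =>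
    Submodule.subset_span ⟨w, hw, rfl⟩
  have h0 := hc _ (hspan 0 C₂.zero_mem) _ (hspan 0 C₂.zero_mem)
  have h1 := hc _ (hspan v hv2) _ (hspan v hv2)
  rw [hinner, inner_cosetState_cosetState, sub_self, if_pos C₁.zero_mem,
    if_pos C₁.zero_mem] at h0
  rw [hinner, inner_cosetState_cosetState, sub_self, if_pos C₁.zero_mem, if_neg hv1] at h1
  exact one_ne_zero (h0.trans h1.symm)

/-- Parameters of a Calderbank-Shor-Steane code. -/
theorem exists_isQuantumCode_cssCode (hle : C₁ ≤ C₂) {k m : ℕ} (hk0 : k ≠ 0)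
    (hk : Module.finrank K C₂ = Module.finrank K C₁ + k)
    (h₂ : ∀ S : Finset (Fin n), S.card < m → ∀ c ∈ C₂, (∀ i ∉ S, c i = 0) → c = 0)
    (h₁ : ∀ S : Finset (Fin n), S.card < m → ∀ w : Fin n → K, ∃ c ∈ C₁, ∀ i ∈ S, c i = w i) :
    ∃ d, IsQuantumCode (cssCode C₁ C₂) k d ∧ m ≤ d := by
  have hne : C₁ ≠ C₂ := by
    rintro rfl
    omega
  obtain ⟨N, hN⟩ := not_detects_univ hle hne
  have hnonempty : {w : ℕ | ∃ (S : Finset (Fin n)) (N : Matrix (S → K) (S → K) ℂ),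
    S.card = w ∧ ¬ Detects (cssCode C₁ C₂) (localOperator S N)}.Nonempty := ⟨_, _, N, rfl, hN⟩
  refine ⟨_, ⟨finrank_cssCode hle hk, Nat.sInf_mem hnonempty, fun _ hw => Nat.sInf_le hw⟩, ?_⟩
  obtain ⟨S, N, hS, hSN⟩ := Nat.sInf_mem hnonempty
  rw [← hS]
  by_contra! hlt
  exact hSN (detects_localOperator hle (h₂ S hlt) (h₁ S hlt) N)

end CSSCodes

/-! ### Parameters of the codes on the curve. -/

section Parameters

variable {K : Type*} [Field K]

theorem charP_five_of_card [Fintype K] (hK : Fintype.card K = 25) : CharP K 5 := by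
  obtain ⟨p, hp⟩ := CharP.exists K
  obtain ⟨n, hpp, hn⟩ := FiniteField.card K p
  have h : p ∣ 5 ^ 2 := by
    rw [show 5 ^ 2 = p ^ (n : ℕ) by rw [← hn, hK]; norm_num]
    exact dvd_pow_self p n.ne_zero
  rwa [(Nat.prime_dvd_prime_iff_eq hpp (by norm_num)).1 (hpp.dvd_of_dvd_pow h)] at hp

variable [CharP K 5]

theorem exists_isQuantumCode_agCode [Fintype K] {n : ℕ} {P : Fin n → Place K (CurveField K)}
    {G : Place K (CurveField K)} (hP : Function.Injective P) (hdeg : ∀ i, (P i).degree = 1)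
    (hG : G.degree = 2) {t₁ t₂ : ℕ} (h1 : 1 < t₁) (h12 : t₁ < t₂) (h2 : 2 * t₂ < n) :
    agCode P (Finsupp.single G (t₁ : ℤ)) ≤ agCode P (Finsupp.single G (t₂ : ℤ)) ∧
      ∃ d : ℕ, IsQuantumCode (cssCode (agCode P (Finsupp.single G (t₁ : ℤ)))
        (agCode P (Finsupp.single G (t₂ : ℤ)))) (2 * (t₂ - t₁)) d ∧
        min (n - 2 * t₂) (2 * t₁ - 2) ≤ d := by
  have hg := hasGenus_curveField K
  have hA : ∀ t : ℤ, ∀ i, (Finsupp.single G t : Divisor K (CurveField K)) (P i) = 0 := by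
    intro t i
    -- G has degree 2, so it is none of the rational places P_i.
    refine Finsupp.single_eq_of_ne fun h => ?_
    have := hdeg i
    rw [h, hG] at this
    omega
  have hd : ∀ t : ℕ, Divisor.degree (Finsupp.single G (t : ℤ)) = 2 * t := by
    intro t
    rw [Divisor.degree_single, hG]
    push_cast
    ring
  have hell : ∀ t : ℕ, 1 < t → (ell (Finsupp.single G (t : ℤ)) : ℤ) = 2 * t - 1 := by
    intro t ht
    rw [ell_eq_degree_sub_one (by rw [hd]; omega), hd]
  have hdim : ∀ t : ℕ, 1 < t → 2 * t < n →
      (Module.finrank K (agCode P (Finsupp.single G (t : ℤ))) : ℤ) = 2 * t - 1 := by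
    intro t ht htn
    rw [finrank_agCode hdeg (hA t) hP hg (by rw [hd]; omega), hell t ht]
  have hle : agCode P (Finsupp.single G (t₁ : ℤ)) ≤ agCode P (Finsupp.single G (t₂ : ℤ)) :=
    agCode_mono (Finsupp.single_le_single.2 (by omega))
  have hd₁ := hdim t₁ h1 (by omega)
  have hd₂ := hdim t₂ (by omega) h2
  refine ⟨hle, exists_isQuantumCode_cssCode hle (by omega) (by omega) (fun S hS c hc hcS => ?_)
    (fun S hS w => ?_)⟩
  · refine eq_zero_of_forall_not_mem hdeg (hA t₂) hP hg ?_ hc hcS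
    rw [hd]
    omega
  · refine exists_mem_agCode_eq hdeg (hA t₁) hP ?_ w
    have hD : Divisor.degree (Finsupp.single G (t₁ : ℤ) - pointDivisor P S) =
        2 * t₁ - S.card := by
      rw [Divisor.degree_sub, hd, degree_pointDivisor hdeg]
    -- |S| < 2t₁ - 2 leaves degree at least 3, exactly the range where ℓ = deg - 1 is known.
    have h3 := ell_eq_degree_sub_one (K := K) (A := Finsupp.single G (t₁ : ℤ) - pointDivisor P S)
      (by rw [hD]; omega)
    have h4 := hell t₁ h1
    rw [hD] at h3
    omega

end Parameters

end AGQuantum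

end

theorem mainTheorem10 (K : Type*) [Field K] [Fintype K] (hK : Fintype.card K = 25) :
    -- the function field of y ^ 5 + y = x ^ 2 is hyperelliptic of genus two
    AGQuantum.HasGenus K (AGQuantum.CurveField K) 2 ∧
    AGQuantum.IsHyperelliptic K (AGQuantum.CurveField K) ∧
    -- 46 distinct rational places and a place of degree two
    ∃ (P : Fin 46 → AGQuantum.Place K (AGQuantum.CurveField K))
      (G : AGQuantum.Place K (AGQuantum.CurveField K)),
      Function.Injective P ∧ (∀ i, (P i).degree = 1) ∧ G.degree = 2 ∧
      ∀ t₁ t₂ : ℕ, 1 < t₁ → t₁ < t₂ → t₂ < 23 →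
        AGQuantum.agCode P (Finsupp.single G (t₁ : ℤ)) ≤
          AGQuantum.agCode P (Finsupp.single G (t₂ : ℤ)) ∧
        ∃ d : ℕ,
          AGQuantum.IsQuantumCode
            (AGQuantum.cssCode (AGQuantum.agCode P (Finsupp.single G (t₁ : ℤ)))
              (AGQuantum.agCode P (Finsupp.single G (t₂ : ℤ))))
            (2 * (t₂ - t₁)) d ∧
          min (46 - 2 * t₂) (2 * t₁ - 2) ≤ d ∧
          (t₁ + t₂ = 24 → AGQuantum.singletonDefect 46 (2 * (t₂ - t₁)) d ≤ 4) := by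
  have := AGQuantum.charP_five_of_card hK
  refine ⟨AGQuantum.hasGenus_curveField K, AGQuantum.isHyperelliptic_curveField K, ?_⟩
  obtain ⟨P, hP, hdeg⟩ := AGQuantum.exists_rational_places hK
  obtain ⟨G, hG⟩ := AGQuantum.exists_degree_two_place hK
  refine ⟨P, G, hP, hdeg, hG, fun t₁ t₂ h1 h12 h2 => ?_⟩
  obtain ⟨hle, d, hcode, hd⟩ :=
    AGQuantum.exists_isQuantumCode_agCode hP hdeg hG h1 h12 (by omega)
  refine ⟨hle, d, hcode, hd, fun h24 => ?_⟩
  -- With t₂ = 24 - t₁ both bounds equal 2t₁ - 2, and 48 - 2(24 - 2t₁) - 2(2t₁ - 2) = 4.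
  unfold AGQuantum.singletonDefect
  omega
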